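/- An algorithm is a recursive function. A ring $S$ is *effective* if it comes with a naming of its elements, i.e. a surjection $\nu$ from a set of codes (words, numbers, finite lists, ...) onto $S$, such that equality of named elements is decidable and addition, negation and multiplication are given by algorithms on codes. An effective ring $S$ *has decidable lifts* if there is an algorithm that, for given matrices $A\in S^{n\times p}$ and $B\in S^{m\times p}$, returns a matrix $X\in S^{m\times n}$ with $XA=B$ or correctly reports that there is none; *decidable colifts* and the *colifting problem* of $S$ are defined in the same way with the equations $AX=B$. Let $k$ be an effective field and let $R$ be an effective associative unital $k$-algebra (the action of scalars is also given by an algorithm) with an enumerable $k$-basis $v_1,v_2,v_3,\dots$, i.e. names of the $v_n$ are computable from $n$. For $i\in\mathbb N$ put $R^i=\langle v_1,\dots,v_i\rangle_k$ and $\Omega^i=\mathrm{End}_k(R^i)$, and let $\omega\in\Omega^i$ act on $R$ by extending it by $\omega(v_j)=0$ for $j>i$. Let $\mathbf C$ be the $k$-linear category with three objects $z_1,z_2,z_3$, with $\mathrm{Hom}(z_j,z_j)=k$, $\mathrm{Hom}(z_1,z_2)=R\oplus\bigoplus_{i\in\mathbb N}\Omega^i$, $\mathrm{Hom}(z_2,z_3)=\mathrm{Hom}(z_1,z_3)=R$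 and all other Hom spaces zero, where composition $\mathrm{Hom}(z_1,z_2)\times\mathrm{Hom}(z_2,z_3)\to\mathrm{Hom}(z_1,z_3)$ is given by the multiplication of $R$ and the action of the $\Omega^i$ on $R$. Let $P$ be the path algebra of $\mathbf C$: the direct sum of all Hom spaces, where $x\cdot y$ is the composite "first $x$, then $y$", and is $0$ for non-composable arrows. Elements of $P$ are named by names of their components, elements of $\Omega^i$ by $i\times i$ matrices over $k$. For $i\in\mathbb N$ let $P^i\subseteq P$ be the subspace of elements whose component in $\mathrm{Hom}(z_1,z_2)$ lies in $R^i\oplus\bigoplus_{j\le i}\Omega^j$ and whose components in $\mathrm{Hom}(z_2,z_3)$ and $\mathrm{Hom}(z_1,z_3)$ lie in $R^i$. Then: 1. $P$ is an effective $k$-algebra (in particular it has decidable equality), and $P$ has decidable lifts. 2. The left-sided systems over $P$ reduce to finite-dimensional linear systems over $k$: every $P^i$ is finite-dimensional; from (names of) matrices $A\in P^{n\times p}$, $B\in P^{m\times p}$ one can compute $d\le d'$ such that all entries of $A$ and $B$ lie in $P^d$ and $R^d\cdot R^d\subseteq R^{d'}$; and for all such $A,B,d,d'$ there is a matrix $X$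 over $P$ with $XA=B$ if and only if there is one with all entries in $P^{d'}$. 3. The colifting problem of $R$ reduces to that of $P$: for matrices $A\in R^{m\times n}$ and $B\in R^{m\times p}$, the system $AX=B$ is solvable over $R$ if and only if it is solvable over $P$ when the entries of $A$ are read in $R\subseteq\mathrm{Hom}(z_1,z_2)$ and those of $B$ in $\mathrm{Hom}(z_1,z_3)=R$. The set of (codes of) solvable systems $AX=B$ over $R$ is many-one reducible to the corresponding set for $P$, and if $P$ has decidable colifts, then so does $R$. -/

import Mathlib

/-! ### Effective rings and their lifting and colifting problems

An algorithm is a recursive function (`Computable`).  A ring is handled algorithmically by naming its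
elements: `ν : C → S` sends a code (an element of a `Primcodable` type) to the ring element it names. -/

namespace EffAlg

/-- `S` is a ring with decidable equality, with respect to the naming `ν` of its elements: every
element has a name, equality of named elements is decidable, and the ring operations are given by
algorithms on names. -/
structure IsEffectiveRing {C S : Type*} [Primcodable C] [Ring S] (ν : C → S) : Prop where
  surj : Function.Surjective ν
  decEq : ComputablePred fun q : C × C => ν q.1 = ν q.2
  add : ∃ f : C → C → C, Computable₂ f ∧ ∀ a b, ν (f a b) = ν a + ν b
  neg : ∃ f : C → C, Computable f ∧ ∀ a, ν (f a) = -ν a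
  mul : ∃ f : C → C → C, Computable₂ f ∧ ∀ a b, ν (f a b) = ν a * ν b

/-- `S` is a `k`-algebra with decidable equality: an effective ring on which the scalars of `k` act by
an algorithm on names. -/
structure IsEffectiveAlgebra {Ck C k S : Type*} [Primcodable Ck] [Primcodable C] [Field k] [Ring S]
    [Algebra k S] (νk : Ck → k) (ν : C → S) : Prop extends IsEffectiveRing ν where
  smul : ∃ f : Ck → C → C, Computable₂ f ∧ ∀ c a, ν (f c a) = νk c • ν a

/-- A sequence of elements of `S` is enumerable if names of its members can be listed by an
algorithm. -/
def IsEnumerable {C S : Type*} [Primcodable C] (ν : C → S) (v : ℕ → S) : Prop :=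
  ∃ g : ℕ → C, Computable g ∧ ∀ n, ν (g n) = v n

/-- Code of a matrix: the list of its rows. -/
abbrev MatCode (C : Type*) := List (List C)

/-- The `m × n` matrix named by a list of rows (entries beyond the end of a list are zero). -/
def readMat {C S : Type*} [Zero S] (ν : C → S) (m n : ℕ) (l : MatCode C) :
    Matrix (Fin m) (Fin n) S :=
  fun i j => ((l[i.1]?.bind fun row => row[j.1]?).map ν).getD 0

/-- Code of a linear system: three sizes `(m, n, p)` and the codes of the matrices `A` and `B`. -/
abbrev SysCode (C : Type*) := (ℕ × ℕ × ℕ) × MatCode C × MatCode C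

/-- Decidable lifts: there is an algorithm that, given matrices `A` (of size `n × p`) and `B` (of size
`m × p`) over `S`, produces an `m × n` matrix `X` over `S` with `X * A = B`, or reports (correctly)
that there is none. -/
def HasDecidableLifts {C S : Type*} [Primcodable C] [Ring S] (ν : C → S) : Prop :=
  ∃ f : SysCode C → Option (MatCode C), Computable f ∧
    ∀ (m n p : ℕ) (a b : MatCode C),
      (∀ x, f ((m, n, p), a, b) = some x →
        readMat ν m n x * readMat ν n p a = readMat ν m p b) ∧
      (f ((m, n, p), a, b) = none →
        ¬ ∃ X : Matrix (Fin m) (Fin n) S, X * readMat ν n p a = readMat ν m p b)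

/-- Decidable colifts: there is an algorithm that, given matrices `A` (of size `m × n`) and `B` (of
size `m × p`) over `S`, produces an `n × p` matrix `X` over `S` with `A * X = B`, or reports
(correctly) that there is none. -/
def HasDecidableColifts {C S : Type*} [Primcodable C] [Ring S] (ν : C → S) : Prop :=
  ∃ f : SysCode C → Option (MatCode C), Computable f ∧
    ∀ (m n p : ℕ) (a b : MatCode C),
      (∀ x, f ((m, n, p), a, b) = some x →
        readMat ν m n a * readMat ν n p x = readMat ν m p b) ∧
      (f ((m, n, p), a, b) = none →
        ¬ ∃ X : Matrix (Fin n) (Fin p) S, readMat ν m n a * X = readMat ν m p b)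

/-- The colifting problem as a decision problem on codes: is `A * X = B` solvable over `S`? -/
def ColiftProblem {C S : Type*} [Ring S] (ν : C → S) (s : SysCode C) : Prop :=
  ∃ X : Matrix (Fin s.1.2.1) (Fin s.1.2.2) S,
    readMat ν s.1.1 s.1.2.1 s.2.1 * X = readMat ν s.1.1 s.1.2.2 s.2.2

/-! ### The operator spaces -/

section Operators

variable {k R : Type*} [Field k] [Ring R] [Algebra k R]

/-- `R^i`, the span of the first `i` vectors of the basis. -/
def truncSpace (v : Module.Basis ℕ k R) (i : ℕ) : Submodule k R :=
  Submodule.span k (Set.range fun j : Fin i => v j)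

/-- The basis of `R^i` formed by the first `i` vectors. -/
noncomputable def truncBasis (v : Module.Basis ℕ k R) (i : ℕ) :
    Module.Basis (Fin i) k (truncSpace v i) :=
  Module.Basis.span (v.linearIndependent.comp (fun j : Fin i => (j : ℕ)) Fin.val_injective)

/-- The projection of `R` onto `R^i` along the span of the remaining basis vectors. -/
noncomputable def truncProj (v : Module.Basis ℕ k R) (i : ℕ) : R →ₗ[k] truncSpace v i :=
  v.constr k fun j => if h : j < i then truncBasis v i ⟨j, h⟩ else 0

/-- `Ω^i`, the space of `k`-linear operators on `R^i`. -/
abbrev Omega (v : Module.Basis ℕ k R) (i : ℕ) : Type _ := truncSpace v i →ₗ[k] truncSpace v i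

/-- The extension of operators from `R^i` to `R` by zero on the span of the remaining basis vectors. -/
noncomputable def extendOp (v : Module.Basis ℕ k R) (i : ℕ) : Omega v i →ₗ[k] Module.End k R where
  toFun ω := (truncSpace v i).subtype ∘ₗ ω ∘ₗ truncProj v i
  map_add' ω ω' := by ext; simp
  map_smul' c ω := by ext; simp

instance (v : Module.Basis ℕ k R) : AddCommGroup (DirectSum ℕ (Omega v)) :=
  @DirectSum.instAddCommGroup ℕ (Omega v) fun _ => inferInstance

/-- The arrows from `z₁` to `z₂`: the space `R ⊕ ⨁ᵢ Ω^i` (the summand `Ω^0` is zero). -/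
abbrev Hom12 (v : Module.Basis ℕ k R) : Type _ := R × DirectSum ℕ (Omega v)

/-- The action of `R ⊕ ⨁ᵢ Ω^i` on `R`: `R` acts by left multiplication and each `Ω^i` by operators. -/
noncomputable def act12 (v : Module.Basis ℕ k R) : Hom12 v →ₗ[k] Module.End k R :=
  (LinearMap.mul k R).coprod (DirectSum.toModule k ℕ (Module.End k R) (extendOp v))

end Operators

/-! ### The path algebra -/

/-- The path algebra of the `k`-linear category with objects `z₁, z₂, z₃`, with
`Hom(zⱼ, zⱼ) = k`, `Hom(z₁, z₂) = R ⊕ ⨁ᵢ Ω^i`, `Hom(z₂, z₃) = Hom(z₁, z₃) = R` and all other Hom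
spaces zero.  An element is a tuple with one component in each nonzero Hom space. -/
@[ext]
structure PathAlgebra {k R : Type*} [Field k] [Ring R] [Algebra k R] (v : Module.Basis ℕ k R) where
  c11 : k
  c22 : k
  c33 : k
  c12 : Hom12 v
  c23 : R
  c13 : R

namespace PathAlgebra

variable {k R : Type*} [Field k] [Ring R] [Algebra k R] {v : Module.Basis ℕ k R}

instance : Zero (PathAlgebra v) := ⟨⟨0, 0, 0, 0, 0, 0⟩⟩
instance : One (PathAlgebra v) := ⟨⟨1, 1, 1, 0, 0, 0⟩⟩
instance : Add (PathAlgebra v) :=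
  ⟨fun x y => ⟨x.c11 + y.c11, x.c22 + y.c22, x.c33 + y.c33, x.c12 + y.c12, x.c23 + y.c23,
    x.c13 + y.c13⟩⟩
instance : Neg (PathAlgebra v) := ⟨fun x => ⟨-x.c11, -x.c22, -x.c33, -x.c12, -x.c23, -x.c13⟩⟩
instance : SMul k (PathAlgebra v) :=
  ⟨fun c x => ⟨c * x.c11, c * x.c22, c * x.c33, c • x.c12, c • x.c23, c • x.c13⟩⟩

/-- The product is composition of arrows, written in the order of the path (`x * y` is `x` followed
by `y`), and zero for arrows that are not composable. -/
noncomputable instance : Mul (PathAlgebra v) :=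
  ⟨fun x y =>
    ⟨x.c11 * y.c11, x.c22 * y.c22, x.c33 * y.c33,
      x.c11 • y.c12 + y.c22 • x.c12,
      x.c22 • y.c23 + y.c33 • x.c23,
      x.c11 • y.c13 + act12 v x.c12 y.c23 + y.c33 • x.c13⟩⟩

section Components

variable (x y : PathAlgebra v) (c : k)

@[simp] theorem zero_c11 : (0 : PathAlgebra v).c11 = 0 := rfl
@[simp] theorem zero_c22 : (0 : PathAlgebra v).c22 = 0 := rfl
@[simp] theorem zero_c33 : (0 : PathAlgebra v).c33 = 0 := rfl
@[simp] theorem zero_c12 : (0 : PathAlgebra v).c12 = 0 := rfl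
@[simp] theorem zero_c23 : (0 : PathAlgebra v).c23 = 0 := rfl
@[simp] theorem zero_c13 : (0 : PathAlgebra v).c13 = 0 := rfl
@[simp] theorem one_c11 : (1 : PathAlgebra v).c11 = 1 := rfl
@[simp] theorem one_c22 : (1 : PathAlgebra v).c22 = 1 := rfl
@[simp] theorem one_c33 : (1 : PathAlgebra v).c33 = 1 := rfl
@[simp] theorem one_c12 : (1 : PathAlgebra v).c12 = 0 := rfl
@[simp] theorem one_c23 : (1 : PathAlgebra v).c23 = 0 := rfl
@[simp] theorem one_c13 : (1 : PathAlgebra v).c13 = 0 := rfl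
@[simp] theorem add_c11 : (x + y).c11 = x.c11 + y.c11 := rfl
@[simp] theorem add_c22 : (x + y).c22 = x.c22 + y.c22 := rfl
@[simp] theorem add_c33 : (x + y).c33 = x.c33 + y.c33 := rfl
@[simp] theorem add_c12 : (x + y).c12 = x.c12 + y.c12 := rfl
@[simp] theorem add_c23 : (x + y).c23 = x.c23 + y.c23 := rfl
@[simp] theorem add_c13 : (x + y).c13 = x.c13 + y.c13 := rfl
@[simp] theorem neg_c11 : (-x).c11 = -x.c11 := rfl
@[simp] theorem neg_c22 : (-x).c22 = -x.c22 := rfl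
@[simp] theorem neg_c33 : (-x).c33 = -x.c33 := rfl
@[simp] theorem neg_c12 : (-x).c12 = -x.c12 := rfl
@[simp] theorem neg_c23 : (-x).c23 = -x.c23 := rfl
@[simp] theorem neg_c13 : (-x).c13 = -x.c13 := rfl
@[simp] theorem smul_c11 : (c • x).c11 = c * x.c11 := rfl
@[simp] theorem smul_c22 : (c • x).c22 = c * x.c22 := rfl
@[simp] theorem smul_c33 : (c • x).c33 = c * x.c33 := rfl
@[simp] theorem smul_c12 : (c • x).c12 = c • x.c12 := rfl
@[simp] theorem smul_c23 : (c • x).c23 = c • x.c23 := rfl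
@[simp] theorem smul_c13 : (c • x).c13 = c • x.c13 := rfl
@[simp] theorem mul_c11 : (x * y).c11 = x.c11 * y.c11 := rfl
@[simp] theorem mul_c22 : (x * y).c22 = x.c22 * y.c22 := rfl
@[simp] theorem mul_c33 : (x * y).c33 = x.c33 * y.c33 := rfl
@[simp] theorem mul_c12 : (x * y).c12 = x.c11 • y.c12 + y.c22 • x.c12 := rfl
@[simp] theorem mul_c23 : (x * y).c23 = x.c22 • y.c23 + y.c33 • x.c23 := rfl
@[simp] theorem mul_c13 :
    (x * y).c13 = x.c11 • y.c13 + act12 v x.c12 y.c23 + y.c33 • x.c13 := rfl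

end Components

noncomputable instance : Ring (PathAlgebra v) where
  add_assoc x y z := by 
    ext1 <;> simp only [add_c11, add_c22, add_c33, add_c12, add_c23, add_c13, add_assoc]
  zero_add x := by ext1 <;> simp
  add_zero x := by ext1 <;> simp
  add_comm x y := by
    ext1 <;> simp only [add_c11, add_c22, add_c33, add_c12, add_c23, add_c13] <;> exact add_comm _ _
  neg_add_cancel x := by ext1 <;> simp
  nsmul := nsmulRec
  zsmul := zsmulRec
  zero_mul x := by ext1 <;> simp
  mul_zero x := by ext1 <;> simp
  one_mul x := by ext1 <;> simp
  mul_one x := by ext1 <;> simp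
  left_distrib x y z := by
    ext1 <;> simp only [mul_c11, mul_c22, mul_c33, mul_c12, mul_c23, mul_c13, add_c11, add_c22,
      add_c33, add_c12, add_c23, add_c13, smul_add, add_smul, map_add, mul_add] <;> abel
  right_distrib x y z := by
    ext1 <;> simp only [mul_c11, mul_c22, mul_c33, mul_c12, mul_c23, mul_c13, add_c11, add_c22,
      add_c33, add_c12, add_c23, add_c13, smul_add, add_smul, map_add, add_mul,
      LinearMap.add_apply] <;> abel
  mul_assoc x y z := by
    ext1 <;> simp only [mul_c11, mul_c22, mul_c33, mul_c12, mul_c23, mul_c13, smul_add, map_add,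
      map_smul, LinearMap.add_apply, LinearMap.smul_apply, mul_assoc, smul_smul]
    · rw [mul_comm z.c22 y.c22, mul_comm z.c22 x.c11, add_assoc]
    · rw [mul_comm z.c33 y.c33, mul_comm z.c33 x.c22, add_assoc]
    · rw [mul_comm z.c33 y.c33, mul_comm z.c33 x.c11]; abel

instance : Module k (PathAlgebra v) where
  one_smul x := by ext1 <;> simp
  mul_smul c d x := by ext1 <;> simp [mul_assoc, mul_smul]
  smul_zero c := by ext1 <;> simp
  smul_add c x y := by ext1 <;> simp [mul_add, smul_add]
  add_smul c d x := by ext1 <;> simp [add_mul, add_smul]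
  zero_smul x := by ext1 <;> simp

noncomputable instance : Algebra k (PathAlgebra v) :=
  Algebra.ofModule
    (fun c x y => by
      ext1 <;> simp [mul_assoc, mul_smul, smul_add, smul_comm c])
    (fun c x y => by
      ext1 <;> simp [mul_left_comm, mul_smul, smul_add, smul_comm c])

/-- An element of `R` as an arrow from `z₁` to `z₂`. -/
def of12 (v : Module.Basis ℕ k R) (r : R) : PathAlgebra v := ⟨0, 0, 0, (r, 0), 0, 0⟩

/-- An element of `R` as an arrow from `z₁` to `z₃`. -/
def of13 (v : Module.Basis ℕ k R) (r : R) : PathAlgebra v := ⟨0, 0, 0, 0, 0, r⟩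

/-- The subspace `P^i` of the path algebra: the diagonal components are arbitrary, the `(1,2)`
component lies in `R^i ⊕ ⨁_{j ≤ i} Ω^j`, and the `(2,3)` and `(1,3)` components lie in `R^i`. -/
def trunc (v : Module.Basis ℕ k R) (i : ℕ) : Submodule k (PathAlgebra v) where
  carrier := {x | x.c12.1 ∈ truncSpace v i ∧ (∀ j, i < j → x.c12.2 j = 0) ∧
    x.c23 ∈ truncSpace v i ∧ x.c13 ∈ truncSpace v i}
  zero_mem' := by simp
  add_mem' := by
    rintro x y ⟨h1, h2, h3, h4⟩ ⟨g1, g2, g3, g4⟩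
    refine ⟨add_mem h1 g1, fun j hj => ?_, add_mem h3 g3, add_mem h4 g4⟩
    simp [h2 j hj, g2 j hj]
  smul_mem' := by
    rintro c x ⟨h1, h2, h3, h4⟩
    refine ⟨Submodule.smul_mem _ c h1, fun j hj => ?_, Submodule.smul_mem _ c h3,
      Submodule.smul_mem _ c h4⟩
    simp [DirectSum.smul_apply, h2 j hj]

/-- Code of an element of the path algebra: codes of the three scalars, of the `(1,2)` component, and
of the `(2,3)` and `(1,3)` components.  The part of the `(1,2)` component in `⨁ᵢ Ω^i` is coded by a
list of pairs of an index `i` and an `i × i` matrix over `k`. -/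
abbrev Code (Ck CR : Type*) := (Ck × Ck × Ck) × (CR × List (ℕ × MatCode Ck)) × CR × CR

/-- The operator on `R^i` whose matrix in the basis of `R^i` is named by `l`. -/
noncomputable def readOp {Ck : Type*} (v : Module.Basis ℕ k R) (νk : Ck → k) (i : ℕ)
    (l : MatCode Ck) : Omega v i :=
  Matrix.toLin (truncBasis v i) (truncBasis v i) (readMat νk i i l)

/-- The element of `⨁ᵢ Ω^i` named by a list of pairs `(i, M)`: the sum, over the list, of the
operators on `R^i` with matrix `M`. -/
noncomputable def readOps {Ck : Type*} (v : Module.Basis ℕ k R) (νk : Ck → k)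
    (l : List (ℕ × MatCode Ck)) : DirectSum ℕ (Omega v) :=
  (l.map fun q : ℕ × MatCode Ck => DirectSum.lof k ℕ (Omega v) q.1 (readOp v νk q.1 q.2)).sum

/-- The naming of the elements of the path algebra induced by namings of the elements of `k` and
`R`. -/
noncomputable def name {Ck CR : Type*} (v : Module.Basis ℕ k R) (νk : Ck → k) (νR : CR → R)
    (c : Code Ck CR) : PathAlgebra v where
  c11 := νk c.1.1
  c22 := νk c.1.2.1
  c33 := νk c.1.2.2
  c12 := (νR c.2.1.1, readOps v νk c.2.1.2)
  c23 := νR c.2.2.1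
  c13 := νR c.2.2.2

end PathAlgebra

end EffAlg

/-! The summands `Ω^i` make left-sided systems over `P` finite-dimensional, while leaving
right-sided ones as hard as over `R`.

In `X * A = B` the unknown arrows `z₁ → z₂` act on the given elements of `R` in the `(2,3)`
components of `A`. If `A` and `B` have entries in `P^d`, only the effect of an unknown on `R^d`,
projected to `R^d'`, matters. Truncating the unknown to `R^d ⊕ ⨁_{j ≤ d} Ω^j` changes this effect,
but the error, compressed to `R^d'`, is itself an operator in `Ω^d'` and can be added back. This
gives an additive map `retract` from `P` into `P^d'` that fixes `P^d` (`retract_of_mem`) and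
commutes with right multiplication by `P^d` (`retract_mul`). Applied to the entries of a solution,
it yields a solution over `P^d'` (`exists_solution_mem_trunc`).

Decidability then follows by unbounded search (`exists_computable_choice`) rather than elimination.
A solution can be verified because `P` is effective. Unsolvability has a finite certificate: a
combination of coordinates that does not vanish on some row of `B` but vanishes on the multiples of
the rows of `A` by a finite family whose span contains `P^d'`. It is sound by the retraction
(`not_exists_of_isCertificate`) and exists by linear algebra (`exists_isCertificate`), so a search
for either object terminates. Coordinates of elements of `R` and codes of operators are found by
search as well; no inversion algorithm in `k` is needed.

For `A * X = B` with `A` in `Hom(z₁, z₂)` and `B` in `Hom(z₁, z₃)`, the `(1,3)` component of the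
product involves only the `(2,3)` component of `X`, an arbitrary element of `R`, so the system is
the original one over `R` (`exists_colift_iff`). -/

namespace EffAlg

/-! ### Decidable predicates and unbounded search -/

section Predicates

variable {α β : Type*} [Primcodable α] [Primcodable β]

theorem computablePred_comp {p : β → Prop} (hp : ComputablePred p) {f : α → β}
    (hf : Computable f) : ComputablePred fun a => p (f a) := by
  classical exact (hp.decide.comp hf).computablePred

theorem computablePred_and {p q : α → Prop} (hp : ComputablePred p) (hq : ComputablePred q) :
    ComputablePred fun a => p a ∧ q a := by
  classical
  refine Computable.computablePred ?_
  refine (Computable.cond hp.decide hq.decide (Computable.const false)).of_eq fun a => ?_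
  by_cases h : p a <;> simp [h]

theorem computablePred_imp {p q : α → Prop} (hp : ComputablePred p) (hq : ComputablePred q) :
    ComputablePred fun a => p a → q a := by
  classical
  refine Computable.computablePred ?_
  refine (Computable.cond hp.decide hq.decide (Computable.const true)).of_eq fun a => ?_
  by_cases h : p a <;> simp [h]

theorem computablePred_nat_lt {f g : α → ℕ} (hf : Computable f) (hg : Computable g) :
    ComputablePred fun a => f a < g a :=
  computablePred_comp (p := fun q : ℕ × ℕ => q.1 < q.2)
    (PrimrecPred.computablePred Primrec.nat_lt) (hf.pair hg)

theorem computablePred_eq [DecidableEq β] {f g : α → β} (hf : Computable f) (hg : Computable g) :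
    ComputablePred fun a => f a = g a :=
  computablePred_comp (p := fun q : β × β => q.1 = q.2)
    (PrimrecPred.computablePred Primrec.eq) (hf.pair hg)

/-- Primitive recursion on the bound, accumulating a conjunction of truth values. -/
theorem computablePred_forall_lt {p : α → ℕ → Prop} {N : α → ℕ}
    (hp : ComputablePred fun q : α × ℕ => p q.1 q.2) (hN : Computable N) :
    ComputablePred fun a => ∀ i < N a, p a i := by
  classical
  refine Computable.computablePred ?_
  have hstep : Computable₂ fun (a : α) (y : ℕ × Bool) => y.2 && decide (p a y.1) :=
    Primrec.and.to_comp.comp (Computable.snd.comp Computable.snd)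
      (hp.decide.comp (Computable.fst.pair (Computable.fst.comp Computable.snd)))
  refine (Computable.nat_rec hN (Computable.const true) hstep).of_eq fun a => ?_
  induction N a with
  | zero => simp
  | succ n ih =>
    simp only [ih]
    rw [Bool.eq_iff_iff]
    simp only [Bool.and_eq_true, decide_eq_true_eq, Nat.lt_succ_iff_lt_or_eq]
    exact ⟨fun h i hi => hi.elim (h.1 i) fun e => e ▸ h.2,
      fun h => ⟨fun i hi => h i (Or.inl hi), h n (Or.inr rfl)⟩⟩

/-- Unbounded search: a decidable relation that is total has a computable choice function. -/
theorem exists_computable_choice {p : α → β → Prop}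
    (hp : ComputablePred fun q : α × β => p q.1 q.2) (h : ∀ a, ∃ b, p a b) :
    ∃ f : α → β, Computable f ∧ ∀ a, p a (f a) := by
  classical
  -- Every candidate in `β` is the decoding of some number, so running through all `n` tests all of
  -- `β`; totality of `p` guarantees a hit.
  let F : α → ℕ → Option β := fun a n =>
    (Encodable.decode n : Option β).bind fun b => cond (decide (p a b)) (some b) none
  have hd : Computable fun q : (α × ℕ) × β => decide (p q.1.1 q.2) :=
    (computablePred_comp (f := fun q : (α × ℕ) × β => (q.1.1, q.2)) hp
      ((Computable.fst.comp Computable.fst).pair Computable.snd)).decide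
  have hc : Computable fun q : (α × ℕ) × β =>
      cond (decide (p q.1.1 q.2)) (some q.2) none :=
    Computable.cond hd (Computable.option_some.comp Computable.snd) (Computable.const none)
  have hdec : Computable fun q : α × ℕ => (Encodable.decode q.2 : Option β) :=
    Computable.decode.comp Computable.snd
  have hF : Computable₂ F := Computable.option_bind hdec hc.to₂
  have hdom : ∀ a, (Nat.rfindOpt (F a)).Dom := fun a => by
    obtain ⟨b, hb⟩ := h a
    exact Nat.rfindOpt_dom.2 ⟨Encodable.encode b, b, by simp [F, hb]⟩
  refine ⟨fun a => (Nat.rfindOpt (F a)).get (hdom a),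
    (Partrec.rfindOpt hF).of_eq_tot fun a => Part.get_mem _, fun a => ?_⟩
  obtain ⟨n, hn⟩ := Nat.rfindOpt_spec (Part.get_mem (hdom a))
  change p a ((Nat.rfindOpt (F a)).get (hdom a))
  generalize (Nat.rfindOpt (F a)).get (hdom a) = x at hn ⊢
  simp only [F, Option.mem_def, Option.bind_eq_some_iff] at hn
  obtain ⟨b, -, hb⟩ := hn
  by_cases hpb : p a b
  · simp only [hpb, decide_true, cond_true, Option.some.injEq] at hb
    exact hb ▸ hpb
  · simp [hpb] at hb

end Predicates

/-! ### Functions computable on names -/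

/-- `f` can be computed on names: there is an algorithm that finds a name of `f a`, given `a`. -/
def ComputableVia {α C S : Type*} [Primcodable α] [Primcodable C] (ν : C → S) (f : α → S) : Prop :=
  ∃ g : α → C, Computable g ∧ ∀ a, ν (g a) = f a

/-- The named elements contain zero and are added by an algorithm. -/
structure IsEffectiveAdd {C S : Type*} [Primcodable C] [AddCommMonoid S] (ν : C → S) : Prop where
  zero : ∃ z, ν z = 0
  add : ∃ f : C → C → C, Computable₂ f ∧ ∀ a b, ν (f a b) = ν a + ν b

namespace ComputableVia

variable {α β C S : Type*} [Primcodable α] [Primcodable β] [Primcodable C] {ν : C → S}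

theorem self : ComputableVia ν ν := ⟨id, Computable.id, fun _ => rfl⟩

theorem of_computable {g : α → C} (hg : Computable g) : ComputableVia ν fun a => ν (g a) :=
  ⟨g, hg, fun _ => rfl⟩

theorem of_eq {f g : α → S} (hf : ComputableVia ν f) (h : ∀ a, f a = g a) : ComputableVia ν g :=
  (funext h : f = g) ▸ hf

theorem comp {f : β → S} (hf : ComputableVia ν f) {h : α → β} (hh : Computable h) :
    ComputableVia ν fun a => f (h a) := by
  obtain ⟨g, hg, e⟩ := hf
  exact ⟨fun a => g (h a), hg.comp hh, fun a => e _⟩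

theorem const (s : S) (h : ∃ c, ν c = s) : ComputableVia ν fun _ : α => s := by
  obtain ⟨c, hc⟩ := h
  exact ⟨fun _ => c, Computable.const c, fun _ => hc⟩

theorem map₂ {C₁ C₂ S₁ S₂ : Type*} [Primcodable C₁] [Primcodable C₂] {ν₁ : C₁ → S₁} {ν₂ : C₂ → S₂}
    {op : S₁ → S₂ → S}
    (hop : ∃ f : C₁ → C₂ → C, Computable₂ f ∧ ∀ a b, ν (f a b) = op (ν₁ a) (ν₂ b))
    {f : α → S₁} {g : α → S₂} (hf : ComputableVia ν₁ f) (hg : ComputableVia ν₂ g) :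
    ComputableVia ν fun a => op (f a) (g a) := by
  obtain ⟨F, hF, eF⟩ := hop
  obtain ⟨f', hf', ef⟩ := hf
  obtain ⟨g', hg', eg⟩ := hg
  exact ⟨fun a => F (f' a) (g' a), hF.comp hf' hg', fun a => by rw [eF, ef, eg]⟩

theorem ite {p : α → Prop} [DecidablePred p] (hp : ComputablePred p) {f g : α → S}
    (hf : ComputableVia ν f) (hg : ComputableVia ν g) :
    ComputableVia ν fun a => if p a then f a else g a := by
  obtain ⟨f', hf', ef⟩ := hf
  obtain ⟨g', hg', eg⟩ := hg
  refine ⟨_, Computable.cond hp.decide hf' hg', fun a => ?_⟩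
  by_cases h : p a <;> simp [h, ef, eg]

theorem option_elim {o : α → Option β} (ho : Computable o) {f : α → S} {g : α → β → S}
    (hf : ComputableVia ν f) (hg : ComputableVia ν fun q : α × β => g q.1 q.2) :
    ComputableVia ν fun a => (o a).elim (f a) (g a) := by
  obtain ⟨f', hf', ef⟩ := hf
  obtain ⟨g', hg', eg⟩ := hg
  refine ⟨_, Computable.option_casesOn ho hf' (g := fun a b => g' (a, b)) hg', fun a => ?_⟩
  simp only
  cases o a <;> simp [ef, eg]

/-- A function can be computed on names by search if its graph is decidable. -/
theorem of_graph (hν : Function.Surjective ν) {f : α → S}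
    (h : ComputablePred fun q : α × C => ν q.2 = f q.1) : ComputableVia ν f :=
  exists_computable_choice (p := fun a c => ν c = f a) h fun a => hν (f a)

section AddCommMonoid

variable [AddCommMonoid S]

theorem add (h : IsEffectiveAdd ν) {f g : α → S} (hf : ComputableVia ν f)
    (hg : ComputableVia ν g) : ComputableVia ν fun a => f a + g a :=
  map₂ h.add hf hg

theorem sum_range (h : IsEffectiveAdd ν) {f : α → ℕ → S} {N : α → ℕ}
    (hf : ComputableVia ν fun q : α × ℕ => f q.1 q.2) (hN : Computable N) :
    ComputableVia ν fun a => ∑ i ∈ Finset.range (N a), f a i := by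
  obtain ⟨z, hz⟩ := h.zero
  obtain ⟨A, hA, eA⟩ := h.add
  obtain ⟨g, hg, eg⟩ := hf
  have hstep : Computable₂ fun (a : α) (y : ℕ × C) => A y.2 (g (a, y.1)) :=
    hA.comp (Computable.snd.comp Computable.snd)
      (hg.comp (Computable.fst.pair (Computable.fst.comp Computable.snd)))
  refine ⟨_, Computable.nat_rec hN (Computable.const z) hstep, fun a => ?_⟩
  simp only
  induction N a with
  | zero => simpa using hz
  | succ n ih => simp only [eA, ih, eg, Finset.sum_range_succ]

/-- The list is traversed by position, with value `0` where `getElem?` returns nothing, which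
reduces the claim to sums over a range. -/
theorem sum_list (h : IsEffectiveAdd ν) {l : α → List β} (hl : Computable l) {f : α → β → S}
    (hf : ComputableVia ν fun q : α × β => f q.1 q.2) :
    ComputableVia ν fun a => ((l a).map (f a)).sum := by
  have h1 : ComputableVia ν fun a =>
      ∑ i ∈ Finset.range (l a).length, ((l a)[i]?).elim 0 (f a) := by
    refine sum_range h (f := fun a i => ((l a)[i]?).elim 0 (f a)) ?_
      (Computable.list_length.comp hl)
    exact option_elim (Computable.list_getElem?.comp (hl.comp Computable.fst) Computable.snd)
      (const 0 h.zero) (g := fun (q : α × ℕ) b => f q.1 b)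
      (hf.comp ((Computable.fst.comp Computable.fst).pair Computable.snd))
  refine h1.of_eq fun a => ?_
  generalize l a = L
  induction L with
  | nil => simp
  | cons b L ih => simp [Finset.sum_range_succ', ih, add_comm]

end AddCommMonoid

end ComputableVia

theorem isEffectiveAdd_nat : IsEffectiveAdd (id : ℕ → ℕ) :=
  ⟨⟨0, rfl⟩, (· + ·), Primrec.nat_add.to_comp, fun _ _ => rfl⟩

theorem ComputableVia.computable {α β : Type*} [Primcodable α] [Primcodable β] {f : α → β}
    (h : ComputableVia id f) : Computable f := by
  obtain ⟨g, hg, e⟩ := h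
  exact hg.of_eq e

theorem computableVia_id {α β : Type*} [Primcodable α] [Primcodable β] {f : α → β}
    (h : Computable f) : ComputableVia id f :=
  ⟨f, h, fun _ => rfl⟩

theorem computable_sum_range {α : Type*} [Primcodable α] {f : α → ℕ → ℕ} {N : α → ℕ}
    (hf : Computable fun q : α × ℕ => f q.1 q.2) (hN : Computable N) :
    Computable fun a => ∑ i ∈ Finset.range (N a), f a i :=
  (ComputableVia.sum_range isEffectiveAdd_nat (computableVia_id hf) hN).computable

namespace IsEffectiveRing

variable {α C S : Type*} [Primcodable α] [Primcodable C] [Ring S] {ν : C → S}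

theorem isEffectiveAdd (h : IsEffectiveRing ν) : IsEffectiveAdd ν := ⟨h.surj 0, h.add⟩

theorem const (h : IsEffectiveRing ν) (s : S) : ComputableVia ν fun _ : α => s :=
  ComputableVia.const s (h.surj s)

theorem computablePred_eq (h : IsEffectiveRing ν) {f g : α → S} (hf : ComputableVia ν f)
    (hg : ComputableVia ν g) : ComputablePred fun a => f a = g a := by
  obtain ⟨f', hf', ef⟩ := hf
  obtain ⟨g', hg', eg⟩ := hg
  refine (computablePred_comp h.decEq (hf'.pair hg')).of_eq fun a => ?_
  simp only [ef, eg]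

theorem computableVia_mul (h : IsEffectiveRing ν) {f g : α → S} (hf : ComputableVia ν f)
    (hg : ComputableVia ν g) : ComputableVia ν fun a => f a * g a :=
  ComputableVia.map₂ h.mul hf hg

theorem computableVia_add (h : IsEffectiveRing ν) {f g : α → S} (hf : ComputableVia ν f)
    (hg : ComputableVia ν g) : ComputableVia ν fun a => f a + g a :=
  ComputableVia.map₂ h.add hf hg

end IsEffectiveRing

/-! ### Coded matrices -/

/-- The entry of a coded matrix at a position given by two natural numbers. -/
def entry {C S : Type*} [Zero S] (ν : C → S) (l : MatCode C) (i j : ℕ) : S :=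
  ((l[i]?.bind fun row => row[j]?).map ν).getD 0

theorem readMat_apply {C S : Type*} [Zero S] (ν : C → S) (m n : ℕ) (l : MatCode C) (i : Fin m)
    (j : Fin n) : readMat ν m n l i j = entry ν l i j := rfl

theorem exists_readMat_eq {C S : Type*} [Zero S] {ν : C → S} (hν : Function.Surjective ν) (m n : ℕ)
    (M : Matrix (Fin m) (Fin n) S) : ∃ l, readMat ν m n l = M := by
  choose c hc using hν
  refine ⟨List.ofFn fun i => List.ofFn fun j => c (M i j), ?_⟩
  ext i j
  simp [readMat, hc]

theorem computable_list_getElem?_bind {C : Type*} [Primcodable C] :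
    Computable fun q : MatCode C × ℕ × ℕ => q.1[q.2.1]?.bind fun row => row[q.2.2]? :=
  Computable.option_bind
    (Computable.list_getElem?.comp Computable.fst (Computable.fst.comp Computable.snd))
    (Computable.list_getElem?.comp Computable.snd
      (Computable.snd.comp (Computable.snd.comp Computable.fst)))

theorem computableVia_entry {C S : Type*} [Primcodable C] [AddCommMonoid S] {ν : C → S}
    (h : IsEffectiveAdd ν) :
    ComputableVia ν fun q : MatCode C × ℕ × ℕ => entry ν q.1 q.2.1 q.2.2 := by
  refine (ComputableVia.option_elim computable_list_getElem?_bind (f := fun _ => (0 : S))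
    (g := fun _ c => ν c)
    (ComputableVia.const 0 h.zero) (ComputableVia.of_computable Computable.snd)).of_eq fun q => ?_
  unfold entry
  cases q.1[q.2.1]?.bind fun row => row[q.2.2]? <;> rfl

/-- Over an effective ring it is decidable whether `X * A = B`, for coded matrices. -/
theorem computablePred_readMat_mul_eq {C S : Type*} [Primcodable C] [Ring S] {ν : C → S}
    (h : IsEffectiveRing ν) :
    ComputablePred fun q : SysCode C × MatCode C =>
      readMat ν q.1.1.1 q.1.1.2.1 q.2 * readMat ν q.1.1.2.1 q.1.1.2.2 q.1.2.1 =
        readMat ν q.1.1.1 q.1.1.2.2 q.1.2.2 := by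
  have he := computableVia_entry h.isEffectiveAdd
  have hs : Computable fun q : ((((SysCode C × MatCode C) × ℕ) × ℕ) × ℕ) => q.1.1.1.1 :=
    Computable.fst.comp (Computable.fst.comp (Computable.fst.comp Computable.fst))
  have hs' : Computable fun q : (((SysCode C × MatCode C) × ℕ) × ℕ) => q.1.1.1 :=
    Computable.fst.comp (Computable.fst.comp Computable.fst)
  have hdim : Computable fun s : SysCode C => s.1 := Computable.fst
  have hrow : Computable fun q : (((SysCode C × MatCode C) × ℕ) × ℕ) => q.1.2 :=
    Computable.snd.comp Computable.fst
  have hB : ComputableVia ν fun q : (((SysCode C × MatCode C) × ℕ) × ℕ) =>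
      entry ν q.1.1.1.2.2 q.1.2 q.2 :=
    he.comp (((Computable.snd.comp Computable.snd).comp hs').pair (hrow.pair Computable.snd))
  have hXA : ComputableVia ν fun q : (((SysCode C × MatCode C) × ℕ) × ℕ) =>
      ∑ t ∈ Finset.range q.1.1.1.1.2.1, entry ν q.1.1.2 q.1.2 t * entry ν q.1.1.1.2.1 t q.2 := by
    refine ComputableVia.sum_range h.isEffectiveAdd
      (f := fun (q : (((SysCode C × MatCode C) × ℕ) × ℕ)) t =>
        entry ν q.1.1.2 q.1.2 t * entry ν q.1.1.1.2.1 t q.2) ?_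
      ((Computable.fst.comp (Computable.snd.comp hdim)).comp hs')
    refine h.computableVia_mul
      (he.comp (f := fun q : MatCode C × ℕ × ℕ => entry ν q.1 q.2.1 q.2.2)
        (h := fun q : ((((SysCode C × MatCode C) × ℕ) × ℕ) × ℕ) => (q.1.1.1.2, q.1.1.2, q.2)) ?_)
      (he.comp (f := fun q : MatCode C × ℕ × ℕ => entry ν q.1 q.2.1 q.2.2)
        (h := fun q : ((((SysCode C × MatCode C) × ℕ) × ℕ) × ℕ) =>
          (q.1.1.1.1.2.1, q.2, q.1.2)) ?_)
    · exact (Computable.snd.comp (Computable.fst.comp (Computable.fst.comp Computable.fst))).pair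
        ((hrow.comp Computable.fst).pair Computable.snd)
    · exact ((Computable.fst.comp Computable.snd).comp hs).pair
        (Computable.snd.pair (Computable.snd.comp Computable.fst))
  refine (computablePred_forall_lt
    (p := fun (q : SysCode C × MatCode C) i => ∀ j < q.1.1.2.2,
      ∑ t ∈ Finset.range q.1.1.2.1, entry ν q.2 i t * entry ν q.1.2.1 t j = entry ν q.1.2.2 i j)
    (computablePred_forall_lt (p := fun (q : (SysCode C × MatCode C) × ℕ) j =>
      ∑ t ∈ Finset.range q.1.1.1.2.1, entry ν q.1.2 q.2 t * entry ν q.1.1.2.1 t j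
        = entry ν q.1.1.2.2 q.2 j) (h.computablePred_eq hXA hB)
      ((Computable.snd.comp (Computable.snd.comp hdim)).comp
        (Computable.fst.comp Computable.fst)))
    ((Computable.fst.comp hdim).comp Computable.fst)).of_eq fun q => ?_
  rw [← Matrix.ext_iff]
  constructor
  · intro H i j
    rw [Matrix.mul_apply, readMat_apply, ← H i i.2 j j.2, Finset.sum_range]
    rfl
  · intro H i hi j hj
    have := H ⟨i, hi⟩ ⟨j, hj⟩
    rw [Matrix.mul_apply] at this
    rw [Finset.sum_range]
    exact this

/-! ### Coordinates on `R` and matrix coefficients on `⨁ᵢ Ω^i` -/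

section Operators

variable {k R : Type*} [Field k] [Ring R] [Algebra k R] (v : Module.Basis ℕ k R)

theorem mem_truncSpace_iff {i : ℕ} {r : R} :
    r ∈ truncSpace v i ↔ ∀ j, i ≤ j → v.repr r j = 0 := by
  have h : truncSpace v i = Submodule.span k (v '' Set.Iio i) := by
    unfold truncSpace
    congr 1
    ext x
    simp only [Set.mem_range, Set.mem_image, Set.mem_Iio]
    exact ⟨fun ⟨j, hj⟩ => ⟨j, j.2, hj⟩, fun ⟨j, hj, e⟩ => ⟨⟨j, hj⟩, e⟩⟩
  rw [h, Module.Basis.mem_span_image]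
  constructor
  · intro hs j hj
    by_contra hne
    exact absurd (hs (Finsupp.mem_support_iff.2 hne)) (not_lt.2 hj)
  · intro hs j hj
    by_contra hne
    exact Finsupp.mem_support_iff.1 hj (hs j (not_lt.1 hne))

theorem truncSpace_mono {i j : ℕ} (h : i ≤ j) : truncSpace v i ≤ truncSpace v j := fun _ hr =>
  (mem_truncSpace_iff v).2 fun l hl => (mem_truncSpace_iff v).1 hr l (h.trans hl)

theorem exists_mem_truncSpace (r : R) : ∃ i, r ∈ truncSpace v i := by
  refine ⟨(v.repr r).support.sup id + 1, (mem_truncSpace_iff v).2 fun j hj => ?_⟩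
  by_contra hne
  have := Finset.le_sup (f := id) (Finsupp.mem_support_iff.2 hne)
  simp only [id] at this
  omega

theorem repr_sum_range (c : ℕ → k) (n j : ℕ) :
    v.repr (∑ i ∈ Finset.range n, c i • v i) j = if j < n then c j else 0 := by
  simp [map_sum, Finsupp.single_apply]

theorem sum_repr_of_mem_truncSpace {i : ℕ} {r : R} (h : r ∈ truncSpace v i) :
    ∑ j ∈ Finset.range i, v.repr r j • v j = r := by
  refine v.repr.injective (Finsupp.ext fun j => ?_)
  rw [repr_sum_range]
  split_ifs with hj
  · rfl
  · exact ((mem_truncSpace_iff v).1 h j (not_lt.1 hj)).symm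

theorem truncBasis_coe (i : ℕ) (j : Fin i) : (truncBasis v i j : R) = v j :=
  congrArg Subtype.val (Module.Basis.span_apply _ _)

theorem truncProj_basis_of_lt {i j : ℕ} (h : j < i) :
    truncProj v i (v j) = truncBasis v i ⟨j, h⟩ := by
  simp [truncProj, Module.Basis.constr_basis, h]

theorem truncProj_basis_of_le {i j : ℕ} (h : i ≤ j) : truncProj v i (v j) = 0 := by
  simp [truncProj, Module.Basis.constr_basis, not_lt.2 h]

theorem truncProj_of_mem {i : ℕ} {r : R} (h : r ∈ truncSpace v i) :
    truncProj v i r = ⟨r, h⟩ := by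
  refine Subtype.ext ?_
  change (truncProj v i r : R) = r
  conv_lhs => rw [← sum_repr_of_mem_truncSpace v h]
  refine Eq.trans ?_ (sum_repr_of_mem_truncSpace v h)
  rw [map_sum, AddSubmonoidClass.coe_finsetSum]
  refine Finset.sum_congr rfl fun j hj => ?_
  rw [map_smul, truncProj_basis_of_lt v (Finset.mem_range.1 hj), Submodule.coe_smul,
    truncBasis_coe]

theorem extendOp_apply (i : ℕ) (ω : Omega v i) (r : R) :
    extendOp v i ω r = ω (truncProj v i r) := rfl

theorem extendOp_mem (i : ℕ) (ω : Omega v i) (r : R) : extendOp v i ω r ∈ truncSpace v i :=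
  (ω (truncProj v i r)).2

/-- This form contains only coefficients, coordinates and basis vectors, all available to an
algorithm; it is how the action of the operators on `R` is computed. -/
theorem extendOp_eq_sum (i : ℕ) (ω : Omega v i) (r : R) :
    extendOp v i ω r = ∑ b ∈ Finset.range i, ∑ a ∈ Finset.range i,
      (v.repr (extendOp v i ω (v b)) a * v.repr r b) • v a := by
  have h : ∀ r, extendOp v i ω r = ∑ b ∈ Finset.range i, v.repr r b • extendOp v i ω (v b) := by
    intro r
    have hl : extendOp v i ω = ∑ b ∈ Finset.range i,
        (v.coord b).smulRight (extendOp v i ω (v b)) := by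
      refine v.ext fun j => ?_
      rw [LinearMap.sum_apply]
      simp only [LinearMap.smulRight_apply, Module.Basis.coord_apply, Module.Basis.repr_self,
        Finsupp.single_apply, ite_smul, one_smul, zero_smul, Finset.sum_ite_eq, Finset.mem_range]
      split_ifs with hj
      · rfl
      · rw [extendOp_apply, truncProj_basis_of_le v (not_lt.1 hj), map_zero, Submodule.coe_zero]
    conv_lhs => rw [hl]
    simp
  rw [h]
  refine Finset.sum_congr rfl fun b _ => ?_
  conv_lhs => rw [← sum_repr_of_mem_truncSpace v (extendOp_mem v i ω (v b)), Finset.smul_sum]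
  exact Finset.sum_congr rfl fun a _ => by rw [smul_smul, mul_comm]

/-- The matrix coefficients of the `i`-th component of an element of `⨁ᵢ Ω^i`. -/
noncomputable def opCoeff (i a b : ℕ) : DirectSum ℕ (Omega v) →ₗ[k] k :=
  v.coord a ∘ₗ LinearMap.applyₗ (v b) ∘ₗ extendOp v i ∘ₗ DirectSum.component k ℕ (Omega v) i

theorem opCoeff_apply (i a b : ℕ) (w : DirectSum ℕ (Omega v)) :
    opCoeff v i a b w = v.repr (extendOp v i (w i) (v b)) a := rfl

theorem opCoeff_eq_zero {i a b : ℕ} (h : ¬(a < i ∧ b < i)) (w : DirectSum ℕ (Omega v)) :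
    opCoeff v i a b w = 0 := by
  rw [opCoeff_apply]
  by_cases ha : a < i
  · have hb : i ≤ b := not_lt.1 fun hb => h ⟨ha, hb⟩
    rw [extendOp_apply, truncProj_basis_of_le v hb]
    simp
  · exact (mem_truncSpace_iff v).1 (extendOp_mem v i _ _) a (not_lt.1 ha)

/-- Each index `i` requires only the `i × i` block of coefficients. Together with a bound on the
nonzero components, equality in `⨁ᵢ Ω^i` becomes a finite check. -/
theorem directSum_ext_opCoeff {w w' : DirectSum ℕ (Omega v)}
    (h : ∀ i, ∀ a < i, ∀ b < i, opCoeff v i a b w = opCoeff v i a b w') : w = w' := by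
  refine DFinsupp.ext fun i => ?_
  refine (truncBasis v i).ext fun b => Subtype.ext ?_
  have he : ∀ u : DirectSum ℕ (Omega v),
      (u i (truncBasis v i b) : R) = extendOp v i (u i) (v b) := fun u => by
    rw [extendOp_apply, truncProj_basis_of_lt v b.2]
  have h1 : extendOp v i (w i) (v b) = extendOp v i (w' i) (v b) := by
    refine v.repr.injective (Finsupp.ext fun a => ?_)
    rw [← opCoeff_apply, ← opCoeff_apply]
    by_cases ha : a < i
    · exact h i a ha b b.2
    · rw [opCoeff_eq_zero v (fun H => ha H.1), opCoeff_eq_zero v (fun H => ha H.1)]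
  exact (he w).trans (h1.trans (he w').symm)

theorem opCoeff_lof_toLin (i a b j : ℕ) (M : ℕ → ℕ → k) :
    opCoeff v i a b (DirectSum.lof k ℕ (Omega v) j
      (Matrix.toLin (truncBasis v j) (truncBasis v j) (Matrix.of fun x y => M x y))) =
      if j = i ∧ a < i ∧ b < i then M a b else 0 := by
  by_cases hj : j = i
  swap
  · rw [opCoeff_apply, DirectSum.lof_eq_of, DirectSum.of_eq_of_ne _ _ _ (Ne.symm hj)]
    simp [hj]
  subst hj
  by_cases hab : a < j ∧ b < j
  swap
  · rw [opCoeff_eq_zero v hab, if_neg fun H => hab H.2]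
  rw [if_pos ⟨rfl, hab⟩, opCoeff_apply, DirectSum.lof_eq_of, DirectSum.of_eq_same, extendOp_apply,
    truncProj_basis_of_lt v hab.2, Matrix.toLin_self, AddSubmonoidClass.coe_finsetSum]
  simp only [Submodule.coe_smul, truncBasis_coe, Matrix.of_apply]
  rw [← Finset.sum_range (fun x => M x b • v x), repr_sum_range, if_pos hab.1]

theorem directSum_eq_sum_lof {N : ℕ} {w : DirectSum ℕ (Omega v)} (h : ∀ i, N ≤ i → w i = 0) :
    w = ∑ i ∈ Finset.range N, DirectSum.lof k ℕ (Omega v) i (w i) := by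
  refine DFinsupp.ext fun j => ?_
  rw [DFinsupp.finsetSum_apply]
  by_cases hj : j < N
  · rw [Finset.sum_eq_single j]
    · exact (DirectSum.of_eq_same _ _).symm
    · exact fun i _ hi => DirectSum.of_eq_of_ne _ _ _ hi.symm
    · exact fun H => absurd (Finset.mem_range.2 hj) H
  · rw [h j (not_lt.1 hj), Finset.sum_eq_zero]
    intro i hi
    refine DirectSum.of_eq_of_ne _ _ _ ?_
    have := Finset.mem_range.1 hi
    omega

theorem toModule_extendOp_eq_sum {N : ℕ} {w : DirectSum ℕ (Omega v)} (h : ∀ i, N ≤ i → w i = 0)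
    (r : R) :
    DirectSum.toModule k ℕ (Module.End k R) (extendOp v) w r =
      ∑ i ∈ Finset.range N, extendOp v i (w i) r := by
  conv_lhs => rw [directSum_eq_sum_lof v h]
  simp only [map_sum, DirectSum.toModule_lof, LinearMap.sum_apply]

theorem act12_apply (x : Hom12 v) (r : R) :
    act12 v x r = x.1 * r + DirectSum.toModule k ℕ (Module.End k R) (extendOp v) x.2 r := rfl

end Operators

/-! ### Codes of elements of `⨁ᵢ Ω^i` -/

namespace PathAlgebra

variable {k R Ck : Type*} [Field k] [Ring R] [Algebra k R] (v : Module.Basis ℕ k R) (νk : Ck → k)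

theorem readOps_cons (q : ℕ × MatCode Ck) (l : List (ℕ × MatCode Ck)) :
    readOps v νk (q :: l) =
      DirectSum.lof k ℕ (Omega v) q.1 (readOp v νk q.1 q.2) + readOps v νk l := by
  simp [readOps]

theorem readOps_append (l l' : List (ℕ × MatCode Ck)) :
    readOps v νk (l ++ l') = readOps v νk l + readOps v νk l' := by
  simp [readOps]

theorem opCoeff_readOps (i a b : ℕ) (l : List (ℕ × MatCode Ck)) :
    opCoeff v i a b (readOps v νk l) =
      (l.map fun q => if q.1 = i ∧ a < i ∧ b < i then entry νk q.2 a b else 0).sum := by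
  induction l with
  | nil => simp [readOps]
  | cons q l ih =>
    rw [readOps_cons, map_add, ih, List.map_cons, List.sum_cons]
    congr 1
    exact opCoeff_lof_toLin v i a b q.1 (entry νk q.2)

/-- A code may repeat an index and is far from unique, so addition is concatenation of lists, and
equality has to be tested on coefficients. -/
theorem readOps_surjective (hk : Function.Surjective νk) : Function.Surjective (readOps v νk) := by
  intro w
  induction w using DirectSum.induction_on with
  | zero => exact ⟨[], by simp [readOps]⟩
  | of i ω =>
    obtain ⟨l, hl⟩ := exists_readMat_eq hk i i
      (LinearMap.toMatrix (truncBasis v i) (truncBasis v i) ω)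
    refine ⟨[(i, l)], ?_⟩
    simp [readOps, readOp, hl, DirectSum.lof_eq_of]
  | add x y hx hy =>
    obtain ⟨l, rfl⟩ := hx
    obtain ⟨l', rfl⟩ := hy
    exact ⟨l ++ l', readOps_append v νk l l'⟩

/-- A bound for the indices of the summands that a list of coded operators involves. -/
def opsBound (l : List (ℕ × MatCode Ck)) : ℕ := (l.map fun q => q.1 + 1).sum

/-- The sum of the numbers `q.1 + 1` exceeds every index in the list. It is a crude bound, but its
computability is just that of list sums. -/
theorem readOps_eq_zero {l : List (ℕ × MatCode Ck)} {i : ℕ} (h : opsBound l ≤ i) :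
    readOps v νk l i = 0 := by
  induction l with
  | nil => simp [readOps]
  | cons q l ih =>
    simp only [opsBound, List.map_cons, List.sum_cons] at h ih
    rw [readOps_cons, DirectSum.add_apply, ih (by omega), DirectSum.lof_eq_of,
      DirectSum.of_eq_of_ne, add_zero]
    omega

end PathAlgebra

/-! ### Computing coordinates in `R` -/

section Coordinates

variable {k R Ck CR : Type*} [Field k] [Ring R] [Algebra k R] [Primcodable Ck] [Primcodable CR]
  {νk : Ck → k} {νR : CR → R} (hk : IsEffectiveRing νk) (hR : IsEffectiveAlgebra νk νR)
  {v : Module.Basis ℕ k R} (hv : IsEnumerable νR v)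

theorem IsEnumerable.computableVia {α : Type*} [Primcodable α] (hv : IsEnumerable νR v) {f : α → ℕ}
    (hf : Computable f) : ComputableVia νR fun a => v (f a) :=
  ComputableVia.comp (f := v) hv hf

theorem IsEffectiveAlgebra.computableVia_smul {α S C : Type*} [Primcodable α] [Primcodable C]
    [Ring S] [Algebra k S] {ν : C → S} (h : IsEffectiveAlgebra νk ν) {f : α → k} {g : α → S}
    (hf : ComputableVia νk f) (hg : ComputableVia ν g) : ComputableVia ν fun a => f a • g a :=
  ComputableVia.map₂ h.smul hf hg

include hk hR hv in
/-- The list of coordinates of an element of `R` can be computed (by search). -/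
theorem exists_computable_coordinates : ∃ L : CR → List Ck, Computable L ∧
    ∀ c i, v.repr (νR c) i = ((L c)[i]?).elim 0 νk := by
  have hcoeff : ComputableVia νk fun q : (CR × List Ck) × ℕ => (q.1.2[q.2]?).elim 0 νk :=
    ComputableVia.option_elim
      (Computable.list_getElem?.comp (Computable.snd.comp Computable.fst) Computable.snd)
      (hk.const 0) (g := fun _ c => νk c) (ComputableVia.of_computable Computable.snd)
  have hsum : ComputableVia νR fun q : CR × List Ck =>
      ∑ i ∈ Finset.range q.2.length, (q.2[i]?).elim 0 νk • v i :=
    ComputableVia.sum_range hR.isEffectiveAdd (f := fun (q : CR × List Ck) i =>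
      (q.2[i]?).elim 0 νk • v i)
      (hR.computableVia_smul hcoeff (hv.computableVia Computable.snd))
      (Computable.list_length.comp Computable.snd)
  -- The search is for a list of scalars whose combination of basis vectors is the given element.
  -- Equality in `R` is decidable, and a list exists because `v` spans.
  obtain ⟨L, hL, e⟩ := exists_computable_choice
    (p := fun (c : CR) (l : List Ck) =>
      ∑ i ∈ Finset.range l.length, (l[i]?).elim 0 νk • v i = νR c)
    (hR.computablePred_eq hsum (ComputableVia.of_computable Computable.fst)) fun c => by
      obtain ⟨n, hn⟩ := exists_mem_truncSpace v (νR c)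
      choose code hcode using hk.surj
      refine ⟨List.ofFn fun i : Fin n => code (v.repr (νR c) i), ?_⟩
      rw [List.length_ofFn]
      refine Eq.trans (Finset.sum_congr rfl fun i hi => ?_) (sum_repr_of_mem_truncSpace v hn)
      simp [Finset.mem_range.1 hi, hcode]
  refine ⟨L, hL, fun c i => ?_⟩
  rw [← e c, repr_sum_range v (fun i => ((L c)[i]?).elim 0 νk)]
  split_ifs with h
  · rfl
  · rw [List.getElem?_eq_none (not_lt.1 h), Option.elim_none]

include hk hR hv in
theorem computableVia_repr {α : Type*} [Primcodable α] {f : α → R} {i : α → ℕ}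
    (hf : ComputableVia νR f) (hi : Computable i) :
    ComputableVia νk fun a => v.repr (f a) (i a) := by
  obtain ⟨L, hL, e⟩ := exists_computable_coordinates hk hR hv
  obtain ⟨g, hg, eg⟩ := hf
  refine (ComputableVia.option_elim (o := fun a => (L (g a))[i a]?)
    (Computable.list_getElem?.comp (hL.comp hg) hi) (hk.const 0) (g := fun _ c => νk c)
    (ComputableVia.of_computable Computable.snd)).of_eq fun a => ?_
  rw [← eg, e]

include hk hR hv in
-- The length of the coordinate list that was found is an upper bound; it need not be the least,
-- since the list may end in zeros.
theorem exists_computable_degree {α : Type*} [Primcodable α] {f : α → R}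
    (hf : ComputableVia νR f) :
    ∃ deg : α → ℕ, Computable deg ∧ ∀ a, f a ∈ truncSpace v (deg a) := by
  obtain ⟨L, hL, e⟩ := exists_computable_coordinates hk hR hv
  obtain ⟨g, hg, eg⟩ := hf
  refine ⟨fun a => (L (g a)).length, Computable.list_length.comp (hL.comp hg), fun a => ?_⟩
  refine (mem_truncSpace_iff v).2 fun j hj => ?_
  rw [← eg, e, List.getElem?_eq_none hj, Option.elim_none]

end Coordinates

/-! ### Effectivity of the path algebra -/

namespace PathAlgebra

variable {k R Ck CR : Type*} [Field k] [Ring R] [Algebra k R] [Primcodable Ck] [Primcodable CR]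
  {νk : Ck → k} {νR : CR → R} (hk : IsEffectiveRing νk) (hR : IsEffectiveAlgebra νk νR)
  {v : Module.Basis ℕ k R} (hv : IsEnumerable νR v)

section Ops

variable {α : Type*} [Primcodable α]

include hk in
theorem computableVia_opCoeff {f : α → DirectSum ℕ (Omega v)} {i a b : α → ℕ}
    (hf : ComputableVia (readOps v νk) f) (hi : Computable i) (ha : Computable a)
    (hb : Computable b) : ComputableVia νk fun x => opCoeff v (i x) (a x) (b x) (f x) := by
  obtain ⟨g, hg, eg⟩ := hf
  have hp : ComputablePred fun q : α × ℕ × MatCode Ck =>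
      q.2.1 = i q.1 ∧ a q.1 < i q.1 ∧ b q.1 < i q.1 :=
    computablePred_and
      (computablePred_eq (Computable.fst.comp Computable.snd) (hi.comp Computable.fst))
      (computablePred_and
        (computablePred_nat_lt (ha.comp Computable.fst) (hi.comp Computable.fst))
        (computablePred_nat_lt (hb.comp Computable.fst) (hi.comp Computable.fst)))
  have he : ComputableVia νk fun q : α × ℕ × MatCode Ck => entry νk q.2.2 (a q.1) (b q.1) :=
    (computableVia_entry hk.isEffectiveAdd).comp ((Computable.snd.comp Computable.snd).pair
      ((ha.comp Computable.fst).pair (hb.comp Computable.fst)))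
  refine (ComputableVia.sum_list hk.isEffectiveAdd hg
    (f := fun x (q : ℕ × MatCode Ck) =>
      if q.1 = i x ∧ a x < i x ∧ b x < i x then entry νk q.2 (a x) (b x) else 0)
    (ComputableVia.ite hp he (hk.const 0))).of_eq fun x => ?_
  rw [← eg, opCoeff_readOps]

theorem computable_opsBound : Computable (opsBound (Ck := Ck)) :=
  (ComputableVia.sum_list isEffectiveAdd_nat Computable.id
    (f := fun _ (q : ℕ × MatCode Ck) => q.1 + 1)
    (computableVia_id (Computable.succ.comp (Computable.fst.comp Computable.snd)))).computable

theorem exists_computable_opsBound {f : α → DirectSum ℕ (Omega v)}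
    (hf : ComputableVia (readOps v νk) f) :
    ∃ N : α → ℕ, Computable N ∧ ∀ x i, N x ≤ i → f x i = 0 := by
  obtain ⟨g, hg, eg⟩ := hf
  exact ⟨fun x => opsBound (g x), computable_opsBound.comp hg, fun x i h => by
    rw [← eg, readOps_eq_zero v νk h]⟩

include hk in
-- The hypotheses concern coefficients and a bound instead of codes, so that the lemma applies to a
-- function for which no code has been computed yet, as in `computableVia_readOps`.
theorem computablePred_ops_eq {f g : α → DirectSum ℕ (Omega v)} {N : α → ℕ}
    (hf : ComputableVia νk fun q : ((α × ℕ) × ℕ) × ℕ => opCoeff v q.1.1.2 q.1.2 q.2 (f q.1.1.1))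
    (hg : ComputableVia νk fun q : ((α × ℕ) × ℕ) × ℕ => opCoeff v q.1.1.2 q.1.2 q.2 (g q.1.1.1))
    (hN : Computable N) (hfN : ∀ x i, N x ≤ i → f x i = 0) (hgN : ∀ x i, N x ≤ i → g x i = 0) :
    ComputablePred fun x => f x = g x := by
  refine (computablePred_forall_lt
    (p := fun x i => ∀ a < i, ∀ b < i, opCoeff v i a b (f x) = opCoeff v i a b (g x))
    (computablePred_forall_lt
      (p := fun (q : α × ℕ) a => ∀ b < q.2, opCoeff v q.2 a b (f q.1) = opCoeff v q.2 a b (g q.1))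
      (computablePred_forall_lt (p := fun (q : (α × ℕ) × ℕ) b =>
        opCoeff v q.1.2 q.2 b (f q.1.1) = opCoeff v q.1.2 q.2 b (g q.1.1))
        (hk.computablePred_eq hf hg) (Computable.snd.comp Computable.fst))
      Computable.snd) hN).of_eq fun x => ⟨fun H => ?_, fun H => by simp [H]⟩
  refine directSum_ext_opCoeff v fun i a ha b hb => ?_
  by_cases hi : i < N x
  · exact H i hi a ha b hb
  · rw [opCoeff_apply, opCoeff_apply, hfN x i (not_lt.1 hi), hgN x i (not_lt.1 hi)]

include hk in
/-- A function into `⨁ᵢ Ω^i` can be computed if its matrix coefficients and a bound for the nonzero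
components can. -/
theorem computableVia_readOps {f : α → DirectSum ℕ (Omega v)} {N : α → ℕ}
    (hf : ComputableVia νk fun q : ((α × ℕ) × ℕ) × ℕ => opCoeff v q.1.1.2 q.1.2 q.2 (f q.1.1.1))
    (hN : Computable N) (hfN : ∀ x i, N x ≤ i → f x i = 0) :
    ComputableVia (readOps v νk) f := by
  -- No code is constructed: it is searched for among all lists, and a candidate is recognised by
  -- comparing coefficients up to a common bound.
  refine ComputableVia.of_graph (readOps_surjective v νk hk.surj) ?_
  have h2 : Computable fun q : (((α × List (ℕ × MatCode Ck)) × ℕ) × ℕ) × ℕ => q.1.1 :=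
    Computable.fst.comp Computable.fst
  refine computablePred_ops_eq hk (N := fun q => opsBound q.2 + N q.1)
    (computableVia_opCoeff hk
      (ComputableVia.of_computable (Computable.snd.comp (Computable.fst.comp h2)))
      (Computable.snd.comp h2) (Computable.snd.comp Computable.fst) Computable.snd)
    (hf.comp (f := fun q : ((α × ℕ) × ℕ) × ℕ => opCoeff v q.1.1.2 q.1.2 q.2 (f q.1.1.1))
      (h := fun q : (((α × List (ℕ × MatCode Ck)) × ℕ) × ℕ) × ℕ =>
        (((q.1.1.1.1, q.1.1.2), q.1.2), q.2))
      ((((Computable.fst.comp (Computable.fst.comp h2)).pair (Computable.snd.comp h2)).pair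
        (Computable.snd.comp Computable.fst)).pair Computable.snd))
    (Primrec.nat_add.to_comp.comp (computable_opsBound.comp Computable.snd)
      (hN.comp Computable.fst))
    (fun q i hi => readOps_eq_zero v νk (by omega)) (fun q i hi => hfN q.1 i (by omega))

include hk in
theorem isEffectiveAdd_readOps : IsEffectiveAdd (readOps v νk) :=
  ⟨readOps_surjective v νk hk.surj 0, (· ++ ·), Computable.list_append,
    fun a b => readOps_append v νk a b⟩

include hk in
theorem computableVia_ops_smul {c : α → k} {f : α → DirectSum ℕ (Omega v)}
    (hc : ComputableVia νk c) (hf : ComputableVia (readOps v νk) f) :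
    ComputableVia (readOps v νk) fun x => c x • f x := by
  obtain ⟨N, hN, e⟩ := exists_computable_opsBound hf
  have h3 : Computable fun q : ((α × ℕ) × ℕ) × ℕ => q.1.1.1 :=
    Computable.fst.comp (Computable.fst.comp Computable.fst)
  have h := hk.computableVia_mul (hc.comp h3) (computableVia_opCoeff hk (hf.comp h3)
    (Computable.snd.comp (Computable.fst.comp Computable.fst))
    (Computable.snd.comp Computable.fst) Computable.snd)
  refine computableVia_readOps hk (h.of_eq fun q => ?_) hN fun x i hi => ?_
  · rw [map_smul, smul_eq_mul]
  · rw [DirectSum.smul_apply, e x i hi, smul_zero]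

include hk hR hv in
theorem computableVia_ops_apply {f : α → DirectSum ℕ (Omega v)} {r : α → R}
    (hf : ComputableVia (readOps v νk) f) (hr : ComputableVia νR r) :
    ComputableVia νR fun x =>
      DirectSum.toModule k ℕ (Module.End k R) (extendOp v) (f x) (r x) := by
  obtain ⟨N, hN, e⟩ := exists_computable_opsBound hf
  have h3 : Computable fun q : ((α × ℕ) × ℕ) × ℕ => q.1.1.1 :=
    Computable.fst.comp (Computable.fst.comp Computable.fst)
  have hi : Computable fun q : ((α × ℕ) × ℕ) × ℕ => q.1.1.2 :=
    Computable.snd.comp (Computable.fst.comp Computable.fst)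
  have hb : Computable fun q : ((α × ℕ) × ℕ) × ℕ => q.1.2 := Computable.snd.comp Computable.fst
  have h : ComputableVia νR fun q : ((α × ℕ) × ℕ) × ℕ =>
      (opCoeff v q.1.1.2 q.2 q.1.2 (f q.1.1.1) * v.repr (r q.1.1.1) q.1.2) • v q.2 :=
    hR.computableVia_smul (hk.computableVia_mul
      (computableVia_opCoeff hk (hf.comp h3) hi Computable.snd hb)
      (computableVia_repr hk hR hv (hr.comp h3) hb)) (hv.computableVia Computable.snd)
  have hadd := hR.isEffectiveAdd
  refine (ComputableVia.sum_range hadd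
    (f := fun x i => ∑ b ∈ Finset.range i, ∑ a ∈ Finset.range i,
      (opCoeff v i a b (f x) * v.repr (r x) b) • v a)
    (ComputableVia.sum_range hadd
      (f := fun (q : α × ℕ) b => ∑ a ∈ Finset.range q.2,
        (opCoeff v q.2 a b (f q.1) * v.repr (r q.1) b) • v a)
      (ComputableVia.sum_range hadd
        (f := fun (q : (α × ℕ) × ℕ) a =>
          (opCoeff v q.1.2 a q.2 (f q.1.1) * v.repr (r q.1.1) q.2) • v a)
        h (Computable.snd.comp Computable.fst)) Computable.snd) hN).of_eq fun x => ?_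
  rw [toModule_extendOp_eq_sum v (e x)]
  refine Finset.sum_congr rfl fun i _ => ?_
  rw [extendOp_eq_sum]
  rfl

end Ops

section Names

variable {α : Type*} [Primcodable α]

theorem computableVia_c11 {f : α → PathAlgebra v} (hf : ComputableVia (name v νk νR) f) :
    ComputableVia νk fun a => (f a).c11 := by
  obtain ⟨g, hg, e⟩ := hf
  exact ⟨fun a => (g a).1.1, (Computable.fst.comp Computable.fst).comp hg,
    fun a => congrArg (fun x => x.c11) (e a)⟩

theorem computableVia_c22 {f : α → PathAlgebra v} (hf : ComputableVia (name v νk νR) f) :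
    ComputableVia νk fun a => (f a).c22 := by
  obtain ⟨g, hg, e⟩ := hf
  exact ⟨fun a => (g a).1.2.1, (Computable.fst.comp (Computable.snd.comp Computable.fst)).comp hg,
    fun a => congrArg (fun x => x.c22) (e a)⟩

theorem computableVia_c33 {f : α → PathAlgebra v} (hf : ComputableVia (name v νk νR) f) :
    ComputableVia νk fun a => (f a).c33 := by
  obtain ⟨g, hg, e⟩ := hf
  exact ⟨fun a => (g a).1.2.2, (Computable.snd.comp (Computable.snd.comp Computable.fst)).comp hg,
    fun a => congrArg (fun x => x.c33) (e a)⟩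

theorem computableVia_c12_fst {f : α → PathAlgebra v} (hf : ComputableVia (name v νk νR) f) :
    ComputableVia νR fun a => (f a).c12.1 := by
  obtain ⟨g, hg, e⟩ := hf
  exact ⟨fun a => (g a).2.1.1, (Computable.fst.comp (Computable.fst.comp Computable.snd)).comp hg,
    fun a => congrArg (fun x => x.c12.1) (e a)⟩

theorem computableVia_c12_snd {f : α → PathAlgebra v} (hf : ComputableVia (name v νk νR) f) :
    ComputableVia (readOps v νk) fun a => (f a).c12.2 := by
  obtain ⟨g, hg, e⟩ := hf
  exact ⟨fun a => (g a).2.1.2, (Computable.snd.comp (Computable.fst.comp Computable.snd)).comp hg,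
    fun a => congrArg (fun x => x.c12.2) (e a)⟩

theorem computableVia_c23 {f : α → PathAlgebra v} (hf : ComputableVia (name v νk νR) f) :
    ComputableVia νR fun a => (f a).c23 := by
  obtain ⟨g, hg, e⟩ := hf
  exact ⟨fun a => (g a).2.2.1, (Computable.fst.comp (Computable.snd.comp Computable.snd)).comp hg,
    fun a => congrArg (fun x => x.c23) (e a)⟩

theorem computableVia_c13 {f : α → PathAlgebra v} (hf : ComputableVia (name v νk νR) f) :
    ComputableVia νR fun a => (f a).c13 := by
  obtain ⟨g, hg, e⟩ := hf
  exact ⟨fun a => (g a).2.2.2, (Computable.snd.comp (Computable.snd.comp Computable.snd)).comp hg,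
    fun a => congrArg (fun x => x.c13) (e a)⟩

theorem computableVia_mk {a b c : α → k} {r s t : α → R} {w : α → DirectSum ℕ (Omega v)}
    (ha : ComputableVia νk a) (hb : ComputableVia νk b) (hc : ComputableVia νk c)
    (hr : ComputableVia νR r) (hw : ComputableVia (readOps v νk) w) (hs : ComputableVia νR s)
    (ht : ComputableVia νR t) :
    ComputableVia (name v νk νR) fun x =>
      (⟨a x, b x, c x, (r x, w x), s x, t x⟩ : PathAlgebra v) := by
  obtain ⟨a', ha, ea⟩ := ha
  obtain ⟨b', hb, eb⟩ := hb
  obtain ⟨c', hc, ec⟩ := hc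
  obtain ⟨r', hr, er⟩ := hr
  obtain ⟨w', hw, ew⟩ := hw
  obtain ⟨s', hs, es⟩ := hs
  obtain ⟨t', ht, et⟩ := ht
  refine ⟨fun x => ((a' x, b' x, c' x), (r' x, w' x), s' x, t' x),
    (ha.pair (hb.pair hc)).pair ((hr.pair hw).pair (hs.pair ht)), fun x => ?_⟩
  simp only [name, ea, eb, ec, er, ew, es, et]

end Names

include hk hR in
theorem name_surjective : Function.Surjective (name v νk νR) := by
  rintro ⟨a, b, c, ⟨r, w⟩, s, t⟩
  obtain ⟨a, rfl⟩ := hk.surj a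
  obtain ⟨b, rfl⟩ := hk.surj b
  obtain ⟨c, rfl⟩ := hk.surj c
  obtain ⟨r, rfl⟩ := hR.surj r
  obtain ⟨w, rfl⟩ := readOps_surjective v νk hk.surj w
  obtain ⟨s, rfl⟩ := hR.surj s
  obtain ⟨t, rfl⟩ := hR.surj t
  exact ⟨((a, b, c), (r, w), s, t), rfl⟩

include hk hR in
theorem computablePred_name_eq :
    ComputablePred fun q : Code Ck CR × Code Ck CR => name v νk νR q.1 = name v νk νR q.2 := by
  have h1 : ComputableVia (name v νk νR) fun q : Code Ck CR × Code Ck CR => name v νk νR q.1 :=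
    ComputableVia.of_computable Computable.fst
  have h2 : ComputableVia (name v νk νR) fun q : Code Ck CR × Code Ck CR => name v νk νR q.2 :=
    ComputableVia.of_computable Computable.snd
  obtain ⟨N, hN, e⟩ := exists_computable_opsBound (computableVia_c12_snd h1)
  obtain ⟨N', hN', e'⟩ := exists_computable_opsBound (computableVia_c12_snd h2)
  have h3 : Computable fun q : (((Code Ck CR × Code Ck CR) × ℕ) × ℕ) × ℕ => q.1.1.1 :=
    Computable.fst.comp (Computable.fst.comp Computable.fst)
  have hi : Computable fun q : (((Code Ck CR × Code Ck CR) × ℕ) × ℕ) × ℕ => q.1.1.2 :=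
    Computable.snd.comp (Computable.fst.comp Computable.fst)
  have ha : Computable fun q : (((Code Ck CR × Code Ck CR) × ℕ) × ℕ) × ℕ => q.1.2 :=
    Computable.snd.comp Computable.fst
  have hops := computablePred_ops_eq hk (N := fun q => N q + N' q)
    (computableVia_opCoeff hk ((computableVia_c12_snd h1).comp h3) hi ha Computable.snd)
    (computableVia_opCoeff hk ((computableVia_c12_snd h2).comp h3) hi ha Computable.snd)
    (Primrec.nat_add.to_comp.comp hN hN')
    (fun q i h => e q i (by omega)) (fun q i h => e' q i (by omega))
  refine (computablePred_and
    (hk.computablePred_eq (computableVia_c11 h1) (computableVia_c11 h2)) <| computablePred_and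
    (hk.computablePred_eq (computableVia_c22 h1) (computableVia_c22 h2)) <| computablePred_and
    (hk.computablePred_eq (computableVia_c33 h1) (computableVia_c33 h2)) <| computablePred_and
    (hR.computablePred_eq (computableVia_c12_fst h1) (computableVia_c12_fst h2)) <|
    computablePred_and hops <| computablePred_and
    (hR.computablePred_eq (computableVia_c23 h1) (computableVia_c23 h2))
    (hR.computablePred_eq (computableVia_c13 h1) (computableVia_c13 h2))).of_eq fun q => ?_
  rw [PathAlgebra.ext_iff, Prod.ext_iff]
  tauto

include hk hR in
theorem computableVia_path_smul {α : Type*} [Primcodable α] {c : α → k} {f : α → PathAlgebra v}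
    (hc : ComputableVia νk c) (hf : ComputableVia (name v νk νR) f) :
    ComputableVia (name v νk νR) fun a => c a • f a :=
  computableVia_mk (hk.computableVia_mul hc (computableVia_c11 hf))
    (hk.computableVia_mul hc (computableVia_c22 hf))
    (hk.computableVia_mul hc (computableVia_c33 hf))
    (hR.computableVia_smul hc (computableVia_c12_fst hf))
    (computableVia_ops_smul hk hc (computableVia_c12_snd hf))
    (hR.computableVia_smul hc (computableVia_c23 hf))
    (hR.computableVia_smul hc (computableVia_c13 hf))

include hk hR hv in
/-- The path algebra is an effective algebra. -/
theorem isEffectiveAlgebra_name : IsEffectiveAlgebra νk (name v νk νR) := by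
  have h1 : ComputableVia (name v νk νR) fun q : Code Ck CR × Code Ck CR => name v νk νR q.1 :=
    ComputableVia.of_computable Computable.fst
  have h2 : ComputableVia (name v νk νR) fun q : Code Ck CR × Code Ck CR => name v νk νR q.2 :=
    ComputableVia.of_computable Computable.snd
  have hops := isEffectiveAdd_readOps hk (v := v)
  refine ⟨⟨name_surjective hk hR, computablePred_name_eq hk hR, ?_, ?_, ?_⟩, ?_⟩
  · obtain ⟨g, hg, e⟩ := computableVia_mk
      (hk.computableVia_add (computableVia_c11 h1) (computableVia_c11 h2))
      (hk.computableVia_add (computableVia_c22 h1) (computableVia_c22 h2))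
      (hk.computableVia_add (computableVia_c33 h1) (computableVia_c33 h2))
      (hR.computableVia_add (computableVia_c12_fst h1) (computableVia_c12_fst h2))
      (ComputableVia.add hops (computableVia_c12_snd h1) (computableVia_c12_snd h2))
      (hR.computableVia_add (computableVia_c23 h1) (computableVia_c23 h2))
      (hR.computableVia_add (computableVia_c13 h1) (computableVia_c13 h2))
    exact ⟨fun a b => g (a, b), hg.to₂, fun a b => e (a, b)⟩
  · obtain ⟨g, hg, e⟩ := computableVia_path_smul hk hR (hk.const (-1))
      (ComputableVia.self (ν := name v νk νR))
    exact ⟨g, hg, fun a => (e a).trans (neg_one_smul k _)⟩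
  · obtain ⟨g, hg, e⟩ := computableVia_mk
      (hk.computableVia_mul (computableVia_c11 h1) (computableVia_c11 h2))
      (hk.computableVia_mul (computableVia_c22 h1) (computableVia_c22 h2))
      (hk.computableVia_mul (computableVia_c33 h1) (computableVia_c33 h2))
      (hR.computableVia_add
        (hR.computableVia_smul (computableVia_c11 h1) (computableVia_c12_fst h2))
        (hR.computableVia_smul (computableVia_c22 h2) (computableVia_c12_fst h1)))
      (ComputableVia.add hops
        (computableVia_ops_smul hk (computableVia_c11 h1) (computableVia_c12_snd h2))
        (computableVia_ops_smul hk (computableVia_c22 h2) (computableVia_c12_snd h1)))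
      (hR.computableVia_add
        (hR.computableVia_smul (computableVia_c22 h1) (computableVia_c23 h2))
        (hR.computableVia_smul (computableVia_c33 h2) (computableVia_c23 h1)))
      (hR.computableVia_add (hR.computableVia_add
        (hR.computableVia_smul (computableVia_c11 h1) (computableVia_c13 h2))
        (hR.computableVia_add
          (hR.computableVia_mul (computableVia_c12_fst h1) (computableVia_c23 h2))
          (computableVia_ops_apply hk hR hv (computableVia_c12_snd h1) (computableVia_c23 h2))))
        (hR.computableVia_smul (computableVia_c33 h2) (computableVia_c13 h1)))
    exact ⟨fun a b => g (a, b), hg.to₂, fun a b => e (a, b)⟩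
  · obtain ⟨g, hg, e⟩ := computableVia_path_smul hk hR
      (ComputableVia.of_computable (ν := νk) (Computable.fst (α := Ck) (β := Code Ck CR)))
      (ComputableVia.of_computable (ν := name v νk νR) Computable.snd)
    exact ⟨fun a b => g (a, b), hg.to₂, fun a b => e (a, b)⟩

end PathAlgebra

/-! ### Separating functionals with finite support -/

/-- Linear functionals that are combinations of finitely many coordinates separate vectors from
finitely generated subspaces. -/
theorem exists_mem_span_proj_of_notMem_span {ι κ k : Type*} [Field k] (g : κ → ι → k)
    (s : Finset κ) (b : ι → k) (hb : b ∉ Submodule.span k (g '' s)) :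
    ∃ Φ ∈ Submodule.span k (Set.range fun i => (LinearMap.proj i : (ι → k) →ₗ[k] k)),
      (∀ t ∈ s, Φ (g t) = 0) ∧ Φ b ≠ 0 := by
  classical
  induction s using Finset.induction_on generalizing b with
  | empty =>
    have hb0 : b ≠ 0 := by simpa using hb
    obtain ⟨i, hi⟩ := Function.ne_iff.1 hb0
    exact ⟨LinearMap.proj i, Submodule.subset_span ⟨i, rfl⟩, by simp, hi⟩
  | insert t s _ ih =>
    have hle : Submodule.span k (g '' s) ≤ Submodule.span k (g '' (insert t s : Finset κ)) :=
      Submodule.span_mono (Set.image_mono (by simp))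
    have ht : g t ∈ Submodule.span k (g '' (insert t s : Finset κ)) :=
      Submodule.subset_span ⟨t, by simp, rfl⟩
    obtain ⟨Φ, hΦ, h0, h1⟩ := ih b fun H => hb (hle H)
    by_cases hΦt : Φ (g t) = 0
    · refine ⟨Φ, hΦ, fun u hu => ?_, h1⟩
      rcases Finset.mem_insert.1 hu with rfl | hu
      exacts [hΦt, h0 u hu]
    -- The vector `b` is corrected by a multiple of `g t` so that `Φ` kills the difference. This
    -- difference is still outside the span of `g '' s`, since otherwise `b` would lie in the larger
    -- span.
    obtain ⟨Ψ, hΨ, h0', h1'⟩ := ih (b - (Φ b / Φ (g t)) • g t) fun H => hb <| by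
      have := add_mem (hle H) (Submodule.smul_mem _ (Φ b / Φ (g t)) ht)
      rwa [sub_add_cancel] at this
    -- The multiple of `Φ` cancels the value of `Ψ` at `g t`. At `b` the new functional takes the
    -- value of `Ψ` at the corrected vector, which is nonzero.
    refine ⟨Ψ - (Ψ (g t) / Φ (g t)) • Φ, sub_mem hΨ (Submodule.smul_mem _ _ hΦ), fun u hu => ?_, ?_⟩
    · rcases Finset.mem_insert.1 hu with rfl | hu
      · simp [div_mul_cancel₀ _ hΦt]
      · simp [h0 u hu, h0' u hu]
    · convert h1' using 1
      simp only [LinearMap.sub_apply, LinearMap.smul_apply, map_sub, map_smul, smul_eq_mul]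
      ring

/-- Turns a functional into a finite list of positions and scalars, which can serve as the object of
a search. -/
theorem exists_list_of_mem_span_proj {ι k : Type*} [Field k] {Φ : (ι → k) →ₗ[k] k}
    (h : Φ ∈ Submodule.span k (Set.range fun i => (LinearMap.proj i : (ι → k) →ₗ[k] k))) :
    ∃ c : List (ι × k), ∀ f, Φ f = (c.map fun q => q.2 * f q.1).sum := by
  induction h using Submodule.span_induction with
  | mem Φ hΦ =>
    obtain ⟨i, rfl⟩ := hΦ
    exact ⟨[(i, 1)], fun f => by simp⟩
  | zero => exact ⟨[], fun f => by simp⟩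
  | add Φ Ψ _ _ hΦ hΨ =>
    obtain ⟨c, hc⟩ := hΦ
    obtain ⟨c', hc'⟩ := hΨ
    exact ⟨c ++ c', fun f => by simp [hc, hc']⟩
  | smul a Φ _ hΦ =>
    obtain ⟨c, hc⟩ := hΦ
    refine ⟨c.map fun q => (q.1, a * q.2), fun f => ?_⟩
    rw [LinearMap.smul_apply, hc, smul_eq_mul, ← List.sum_map_mul_left, List.map_map]
    congr 2
    ext q
    simp [mul_assoc]

namespace PathAlgebra

variable {k R : Type*} [Field k] [Ring R] [Algebra k R] (v : Module.Basis ℕ k R)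

/-! ### The retraction onto bounded degree -/

section Retract

/-- The truncation of arrows from `z₁` to `z₂` to `R^d ⊕ ⨁_{j ≤ d} Ω^j`. -/
noncomputable def cut12 (d : ℕ) : Hom12 v →ₗ[k] Hom12 v :=
  ((truncSpace v d).subtype ∘ₗ truncProj v d).prodMap
    (∑ i ∈ Finset.range (d + 1),
      DirectSum.lof k ℕ (Omega v) i ∘ₗ DirectSum.component k ℕ (Omega v) i)

/-- Operators on `R` compressed to `R^d`, as elements of `⨁ᵢ Ω^i`. -/
noncomputable def compress (d : ℕ) : Module.End k R →ₗ[k] DirectSum ℕ (Omega v) where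
  toFun φ := DirectSum.lof k ℕ (Omega v) d (truncProj v d ∘ₗ φ ∘ₗ (truncSpace v d).subtype)
  map_add' φ ψ := by rw [LinearMap.add_comp, LinearMap.comp_add, map_add]
  map_smul' c φ := by rw [LinearMap.smul_comp, LinearMap.comp_smul, map_smul, RingHom.id_apply]

/-- Arrows from `z₁` to `z₂` are truncated, and the difference in their action is made up for by an
operator in `Ω^d'`. -/
noncomputable def retract12 (d d' : ℕ) : Hom12 v →ₗ[k] Hom12 v :=
  cut12 v d + LinearMap.inr k R _ ∘ₗ compress v d' ∘ₗ act12 v ∘ₗ (LinearMap.id - cut12 v d)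

theorem cut12_fst (d : ℕ) (x : Hom12 v) : (cut12 v d x).1 = truncProj v d x.1 := rfl

theorem cut12_snd (d : ℕ) (x : Hom12 v) : (cut12 v d x).2 =
    ∑ i ∈ Finset.range (d + 1), DirectSum.lof k ℕ (Omega v) i (x.2 i) := by
  simp only [cut12, LinearMap.prodMap_apply, LinearMap.sum_apply]
  rfl

theorem cut12_snd_apply_eq_zero {d j : ℕ} (h : d < j) (x : Hom12 v) : (cut12 v d x).2 j = 0 := by
  rw [cut12_snd, DFinsupp.finsetSum_apply]
  refine Finset.sum_eq_zero fun i hi => DirectSum.of_eq_of_ne _ _ _ ?_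
  have := Finset.mem_range.1 hi
  omega

theorem cut12_of_mem {d : ℕ} {x : Hom12 v} (h1 : x.1 ∈ truncSpace v d)
    (h2 : ∀ j, d < j → x.2 j = 0) : cut12 v d x = x := by
  refine Prod.ext ?_ ?_
  · rw [cut12_fst, truncProj_of_mem v h1]
  · rw [cut12_snd]
    exact (directSum_eq_sum_lof v fun i hi => h2 i hi).symm

/-- The ring part of the cut sends `R^d` into `R^d * R^d ⊆ R^d'`, and each remaining operator has
its image in some `R^i` with `i ≤ d ≤ d'`. -/
theorem act12_cut12_mem {d d' : ℕ} (h : d ≤ d')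
    (hmul : ∀ r ∈ truncSpace v d, ∀ s ∈ truncSpace v d, r * s ∈ truncSpace v d')
    (x : Hom12 v) {s : R} (hs : s ∈ truncSpace v d) :
    act12 v (cut12 v d x) s ∈ truncSpace v d' := by
  rw [act12_apply, toModule_extendOp_eq_sum v (N := d + 1)
    fun i hi => cut12_snd_apply_eq_zero v hi x]
  refine add_mem (hmul _ (Subtype.prop _) _ hs) (sum_mem fun i hi => ?_)
  have := Finset.mem_range.1 hi
  exact truncSpace_mono v (by omega) (extendOp_mem v i _ _)

theorem act12_inr_compress (d : ℕ) (φ : Module.End k R) {s : R} (hs : s ∈ truncSpace v d) :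
    act12 v (0, compress v d φ) s = truncProj v d (φ s) := by
  rw [act12_apply]
  simp only [compress, LinearMap.coe_mk, AddHom.coe_mk, DirectSum.toModule_lof, zero_mul, zero_add]
  rw [extendOp_apply, truncProj_of_mem v hs]
  rfl

theorem retract12_apply (d d' : ℕ) (x : Hom12 v) : retract12 v d d' x =
    cut12 v d x + (0, compress v d' (act12 v (x - cut12 v d x))) := rfl

theorem retract12_of_mem {d d' : ℕ} {x : Hom12 v} (h1 : x.1 ∈ truncSpace v d)
    (h2 : ∀ j, d < j → x.2 j = 0) : retract12 v d d' x = x := by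
  rw [retract12_apply, cut12_of_mem v h1 h2, sub_self, map_zero, map_zero]
  exact add_zero x

/-- On `R^d` the correction term contributes the projected action of `x - cut12 v d x`. The cut
already maps `R^d` into `R^d'`, so projecting does not change its action, and the two contributions
add up to the projected action of `x`. -/
theorem act12_retract12 {d d' : ℕ} (h : d ≤ d')
    (hmul : ∀ r ∈ truncSpace v d, ∀ s ∈ truncSpace v d, r * s ∈ truncSpace v d')
    (x : Hom12 v) {s : R} (hs : s ∈ truncSpace v d) :
    act12 v (retract12 v d d' x) s = truncProj v d' (act12 v x s) := by
  rw [retract12_apply, map_add, LinearMap.add_apply,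
    act12_inr_compress v d' _ (truncSpace_mono v h hs), map_sub, LinearMap.sub_apply, map_sub,
    truncProj_of_mem v (act12_cut12_mem v h hmul x hs), Submodule.coe_sub]
  exact add_sub_cancel _ _

theorem retract12_fst_mem {d d' : ℕ} (h : d ≤ d') (x : Hom12 v) :
    (retract12 v d d' x).1 ∈ truncSpace v d' := by
  rw [retract12_apply, Prod.fst_add, add_zero, cut12_fst]
  exact truncSpace_mono v h (Subtype.prop _)

theorem retract12_snd_eq_zero {d d' j : ℕ} (h : d ≤ d') (hj : d' < j) (x : Hom12 v) :
    (retract12 v d d' x).2 j = 0 := by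
  rw [retract12_apply, Prod.snd_add, DirectSum.add_apply,
    cut12_snd_apply_eq_zero v (h.trans_lt hj), zero_add]
  exact DirectSum.of_eq_of_ne _ _ _ hj.ne'

/-- A retraction of the path algebra into `P^d'` that commutes with right multiplication by elements
of `P^d`. -/
noncomputable def retract (d d' : ℕ) : PathAlgebra v →+ PathAlgebra v where
  toFun x := ⟨x.c11, x.c22, x.c33, retract12 v d d' x.c12, truncProj v d' x.c23,
    truncProj v d' x.c13⟩
  map_zero' := by ext1 <;> simp
  map_add' x y := by ext1 <;> simp

theorem retract_mem {d d' : ℕ} (h : d ≤ d') (x : PathAlgebra v) :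
    retract v d d' x ∈ trunc v d' :=
  ⟨retract12_fst_mem v h x.c12, fun _ hj => retract12_snd_eq_zero v h hj x.c12,
    Subtype.prop _, Subtype.prop _⟩

theorem retract_of_mem {d d' : ℕ} (h : d ≤ d') {x : PathAlgebra v} (hx : x ∈ trunc v d) :
    retract v d d' x = x := by
  obtain ⟨h1, h2, h3, h4⟩ := hx
  ext1
  · rfl
  · rfl
  · rfl
  · exact retract12_of_mem v h1 h2
  · exact congrArg Subtype.val (truncProj_of_mem v (truncSpace_mono v h h3))
  · exact congrArg Subtype.val (truncProj_of_mem v (truncSpace_mono v h h4))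

/-- All components of the product other than `(1,3)` involve only scalar multiples, so linearity and
the fact that the entries of `a` are fixed suffice. The action in the `(1,3)` component is
`act12_retract12`, which applies because `a.c23` lies in `R^d`. -/
theorem retract_mul {d d' : ℕ} (h : d ≤ d')
    (hmul : ∀ r ∈ truncSpace v d, ∀ s ∈ truncSpace v d, r * s ∈ truncSpace v d')
    (x : PathAlgebra v) {a : PathAlgebra v} (ha : a ∈ trunc v d) :
    retract v d d' (x * a) = retract v d d' x * a := by
  obtain ⟨h1, h2, h3, h4⟩ := ha
  have e3 : (truncProj v d' a.c23 : R) = a.c23 :=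
    congrArg Subtype.val (truncProj_of_mem v (truncSpace_mono v h h3))
  have e4 : (truncProj v d' a.c13 : R) = a.c13 :=
    congrArg Subtype.val (truncProj_of_mem v (truncSpace_mono v h h4))
  have e1 : retract12 v d d' a.c12 = a.c12 := retract12_of_mem v h1 h2
  have e5 := act12_retract12 v h hmul x.c12 h3
  ext1
  · rfl
  · rfl
  · rfl
  · change retract12 v d d' (x.c11 • a.c12 + a.c22 • x.c12) =
      x.c11 • a.c12 + a.c22 • retract12 v d d' x.c12
    rw [map_add, map_smul, map_smul, e1]
  · change (truncProj v d' (x.c22 • a.c23 + a.c33 • x.c23) : R) =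
      x.c22 • a.c23 + a.c33 • (truncProj v d' x.c23 : R)
    rw [map_add, map_smul, map_smul, Submodule.coe_add, Submodule.coe_smul, Submodule.coe_smul, e3]
  · change (truncProj v d' (x.c11 • a.c13 + act12 v x.c12 a.c23 + a.c33 • x.c13) : R) =
      x.c11 • a.c13 + act12 v (retract12 v d d' x.c12) a.c23 +
        a.c33 • (truncProj v d' x.c13 : R)
    rw [map_add, map_add, map_smul, map_smul, Submodule.coe_add, Submodule.coe_add,
      Submodule.coe_smul, Submodule.coe_smul, e4, e5]

/-- If `X * A = B` is solvable and the entries of `A` and `B` lie in `P^d`, then there is a solution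
with entries in `P^d'`. -/
theorem exists_solution_mem_trunc {m n p : Type*} [Fintype n]
    {A : Matrix n p (PathAlgebra v)} {B : Matrix m p (PathAlgebra v)} {d d' : ℕ} (h : d ≤ d')
    (hmul : ∀ r ∈ truncSpace v d, ∀ s ∈ truncSpace v d, r * s ∈ truncSpace v d')
    (hA : ∀ i j, A i j ∈ trunc v d) (hB : ∀ i j, B i j ∈ trunc v d)
    {X : Matrix m n (PathAlgebra v)} (hX : X * A = B) :
    ∃ Y : Matrix m n (PathAlgebra v), (∀ i j, Y i j ∈ trunc v d') ∧ Y * A = B := by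
  -- Entrywise, the retraction passes through right multiplication by `A` and fixes `B`, so it
  -- carries the equation `X * A = B` to the new matrix.
  refine ⟨X.map (retract v d d'), fun i j => retract_mem v h _, ?_⟩
  ext1 i j
  rw [← retract_of_mem v h (hB i j), ← hX, Matrix.mul_apply, Matrix.mul_apply, map_sum]
  exact Finset.sum_congr rfl fun l _ => (retract_mul v h hmul _ (hA l j)).symm

end Retract

theorem trunc_mono {i j : ℕ} (h : i ≤ j) : trunc v i ≤ trunc v j := fun _ hx =>
  ⟨truncSpace_mono v h hx.1, fun l hl => hx.2.1 l (h.trans_lt hl), truncSpace_mono v h hx.2.2.1,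
    truncSpace_mono v h hx.2.2.2⟩

/-! ### A computable sequence of generators -/

section Generators

/-- The operator on `R^i` that sends `v b` to `v a` and the other basis vectors to zero. -/
noncomputable def unitOp (i a b : ℕ) : DirectSum ℕ (Omega v) :=
  DirectSum.lof k ℕ (Omega v) i (Matrix.toLin (truncBasis v i) (truncBasis v i)
    (Matrix.of fun x y => if (x : ℕ) = a ∧ (y : ℕ) = b then 1 else 0))

theorem opCoeff_unitOp (i a b j x y : ℕ) : opCoeff v i a b (unitOp v j x y) =
    if j = i ∧ a < i ∧ b < i then if a = x ∧ b = y then 1 else 0 else 0 :=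
  opCoeff_lof_toLin v i a b j fun a b => if a = x ∧ b = y then 1 else 0

theorem unitOp_apply_eq_zero {i j : ℕ} (h : i < j) (a b : ℕ) : unitOp v i a b j = 0 :=
  DirectSum.of_eq_of_ne _ _ _ h.ne'

/-- All three indices run over the same range, independently of `i`: terms with `a ≥ i` or `b ≥ i`
have coefficient zero. -/
theorem eq_sum_unitOp {d : ℕ} {w : DirectSum ℕ (Omega v)} (h : ∀ j, d < j → w j = 0) :
    w = ∑ i ∈ Finset.range (d + 1), ∑ a ∈ Finset.range (d + 1), ∑ b ∈ Finset.range (d + 1),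
      opCoeff v i a b w • unitOp v i a b := by
  refine directSum_ext_opCoeff v fun j x hx y hy => ?_
  simp only [map_sum, map_smul, opCoeff_unitOp, hx, hy, and_self, and_true, smul_eq_mul]
  by_cases hj : j < d + 1
  · rw [Finset.sum_eq_single j, Finset.sum_eq_single x, Finset.sum_eq_single y]
    · simp
    · intro b _ hb
      simp [hb.symm]
    · exact fun H => absurd (Finset.mem_range.2 (by omega)) H
    · intro a _ ha
      simp [ha.symm]
    · exact fun H => absurd (Finset.mem_range.2 (by omega)) H
    · intro i _ hi
      simp [hi]
    · exact fun H => absurd (Finset.mem_range.2 hj) H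
  · rw [opCoeff_apply, h j (by omega), map_zero, LinearMap.zero_apply, map_zero, Finsupp.zero_apply]
    refine (Finset.sum_eq_zero fun i hi => ?_).symm
    have : i ≠ j := by
      have := Finset.mem_range.1 hi
      omega
    simp [this]

/-- Generators of the path algebra as a vector space; the first index selects the component. -/
noncomputable def gen (t : ℕ × ℕ × ℕ × ℕ) : PathAlgebra v where
  c11 := if t.1 = 0 then 1 else 0
  c22 := if t.1 = 1 then 1 else 0
  c33 := if t.1 = 2 then 1 else 0
  c12 := (if t.1 = 3 then v t.2.1 else 0,
    if t.1 = 6 then unitOp v t.2.1 t.2.2.1 t.2.2.2 else 0)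
  c23 := if t.1 = 4 then v t.2.1 else 0
  c13 := if t.1 = 5 then v t.2.1 else 0

/-- The inclusion of `Hom(z₁, z₂)`. -/
def incl12 : Hom12 v →ₗ[k] PathAlgebra v where
  toFun x := ⟨0, 0, 0, x, 0, 0⟩
  map_add' x y := by ext1 <;> simp
  map_smul' c x := by ext1 <;> simp

/-- The inclusion of `Hom(z₂, z₃)`. -/
def incl23 : R →ₗ[k] PathAlgebra v where
  toFun x := ⟨0, 0, 0, 0, x, 0⟩
  map_add' x y := by ext1 <;> simp
  map_smul' c x := by ext1 <;> simp

/-- The inclusion of `Hom(z₁, z₃)`. -/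
def incl13 : R →ₗ[k] PathAlgebra v where
  toFun x := ⟨0, 0, 0, 0, 0, x⟩
  map_add' x y := by ext1 <;> simp
  map_smul' c x := by ext1 <;> simp

/-- A bound for the codes of the generators of `P^d`. -/
def genBound (d : ℕ) : ℕ := Nat.pair 7 (Nat.pair (d + 1) (Nat.pair (d + 1) (d + 1)))

/-- `Nat.pair` is strictly increasing in each argument, so all required generators occur in an
initial segment of the sequence. The segment also contains others, possibly outside `P^d`; only the
inclusion of `P^d` in its span is needed. -/
theorem encode_lt_genBound {d t i a b : ℕ} (ht : t < 7) (hi : i ≤ d) (ha : a ≤ d) (hb : b ≤ d) :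
    Encodable.encode (t, i, a, b) < genBound d := by
  simp only [Encodable.encode_prod_val, Encodable.encode_nat, genBound]
  have h : ∀ {a b c d : ℕ}, a < c → b < d → Nat.pair a b < Nat.pair c d := fun hac hbd =>
    (Nat.pair_lt_pair_left _ hac).trans (Nat.pair_lt_pair_right _ hbd)
  exact h ht (h (by omega) (h (by omega) (by omega)))

/-- The sequence of all generators. -/
noncomputable def genSeq (n : ℕ) : PathAlgebra v := gen v (Denumerable.ofNat _ n)

theorem gen_mem_span {d t i a b : ℕ} (ht : t < 7) (hi : i ≤ d) (ha : a ≤ d) (hb : b ≤ d) :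
    gen v (t, i, a, b) ∈ Submodule.span k (genSeq v '' Finset.range (genBound d)) := by
  refine Submodule.subset_span ⟨Encodable.encode (t, i, a, b), ?_, ?_⟩
  · simpa using encode_lt_genBound ht hi ha hb
  · rw [genSeq, Denumerable.ofNat_encode]

theorem trunc_le_span (d : ℕ) :
    trunc v d ≤ Submodule.span k (genSeq v '' Finset.range (genBound d)) := by
  rintro x ⟨h1, h2, h3, h4⟩
  set G := Submodule.span k (genSeq v '' Finset.range (genBound d))
  have key : ∀ (F : R →ₗ[k] PathAlgebra v) (t : ℕ), t < 7 → (∀ i, F (v i) = gen v (t, i, 0, 0)) →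
      ∀ r ∈ truncSpace v d, F r ∈ G := by
    intro F t ht hF r hr
    rw [← sum_repr_of_mem_truncSpace v hr, map_sum]
    refine sum_mem fun i hi => ?_
    rw [map_smul, hF]
    exact Submodule.smul_mem _ _
      (gen_mem_span v ht (Finset.mem_range.1 hi).le (Nat.zero_le _) (Nat.zero_le _))
  have hops : incl12 v (0, x.c12.2) ∈ G := by
    have : incl12 v (0, x.c12.2) = (incl12 v ∘ₗ LinearMap.inr k R _) x.c12.2 := rfl
    rw [this, eq_sum_unitOp v h2]
    simp only [map_sum, map_smul]
    refine sum_mem fun i hi => sum_mem fun a ha => sum_mem fun b hb => Submodule.smul_mem _ _ ?_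
    rw [Finset.mem_range] at hi ha hb
    convert gen_mem_span v (t := 6) (by omega) (Nat.lt_succ_iff.1 hi) (Nat.lt_succ_iff.1 ha)
      (Nat.lt_succ_iff.1 hb) using 1
    ext1 <;> simp [incl12, gen]
  have hx : x = x.c11 • gen v (0, 0, 0, 0) + x.c22 • gen v (1, 0, 0, 0) +
      x.c33 • gen v (2, 0, 0, 0) + (incl12 v ∘ₗ LinearMap.inl k R _) x.c12.1 +
      incl12 v (0, x.c12.2) + incl23 v x.c23 + incl13 v x.c13 := by
    ext1 <;> simp [gen, incl12, incl23, incl13]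
  rw [hx]
  refine add_mem (add_mem (add_mem (add_mem (add_mem (add_mem ?_ ?_) ?_) ?_) hops) ?_) ?_
  · exact Submodule.smul_mem _ _ (gen_mem_span v (by omega) d.zero_le d.zero_le d.zero_le)
  · exact Submodule.smul_mem _ _ (gen_mem_span v (by omega) d.zero_le d.zero_le d.zero_le)
  · exact Submodule.smul_mem _ _ (gen_mem_span v (by omega) d.zero_le d.zero_le d.zero_le)
  · exact key _ 3 (by omega) (fun i => by ext1 <;> simp [incl12, gen]) _ h1
  · exact key _ 4 (by omega) (fun i => by ext1 <;> simp [incl23, gen, Prod.zero_eq_mk]) _ h3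
  · exact key _ 5 (by omega) (fun i => by ext1 <;> simp [incl13, gen, Prod.zero_eq_mk]) _ h4

theorem finiteDimensional_trunc (d : ℕ) : FiniteDimensional k (trunc v d) := by
  have : FiniteDimensional k (Submodule.span k (genSeq v '' Finset.range (genBound d))) :=
    FiniteDimensional.span_of_finite k (((Finset.range _).finite_toSet).image _)
  exact Submodule.finiteDimensional_of_le (trunc_le_span v d)

end Generators

/-! ### Coordinate functionals of the path algebra -/

section Functionals

/-- Coordinate functionals of the path algebra; the first index selects the component. -/
noncomputable def coord (t : ℕ × ℕ × ℕ × ℕ) : PathAlgebra v →ₗ[k] k where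
  toFun x :=
    if t.1 = 0 then x.c11 else if t.1 = 1 then x.c22 else if t.1 = 2 then x.c33 else
    if t.1 = 3 then v.repr x.c12.1 t.2.1 else if t.1 = 4 then v.repr x.c23 t.2.1 else
    if t.1 = 5 then v.repr x.c13 t.2.1 else opCoeff v t.2.1 t.2.2.1 t.2.2.2 x.c12.2
  map_add' x y := by split_ifs <;> simp
  map_smul' c x := by split_ifs <;> simp

theorem ext_coord {x y : PathAlgebra v} (h : ∀ t, coord v t x = coord v t y) : x = y := by
  ext1
  · exact h (0, 0, 0, 0)
  · exact h (1, 0, 0, 0)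
  · exact h (2, 0, 0, 0)
  · refine Prod.ext (v.repr.injective (Finsupp.ext fun i => h (3, i, 0, 0))) ?_
    exact directSum_ext_opCoeff v fun i a _ b _ => h (6, i, a, b)
  · exact v.repr.injective (Finsupp.ext fun i => h (4, i, 0, 0))
  · exact v.repr.injective (Finsupp.ext fun i => h (5, i, 0, 0))

end Functionals

/-! ### Right-sided systems -/

section Colift

/-- The `(1,3)` component is a product in `R` and sees only `x.c23`; the `(1,2)` component
disappears as soon as `x.c22 = 0`, as it does for arrows `z₂ → z₃`. -/
theorem of12_mul (r : R) (x : PathAlgebra v) :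
    of12 v r * x = ⟨0, 0, 0, x.c22 • (r, 0), 0, r * x.c23⟩ := by
  ext1 <;> simp [of12, act12_apply]

theorem mul_map_c23_of_colift {m n p : Type*} [Fintype n] {A : Matrix m n R} {B : Matrix m p R}
    {X : Matrix n p (PathAlgebra v)} (hX : A.map (of12 v) * X = B.map (of13 v)) :
    A * X.map c23 = B := by
  ext i j
  let π : PathAlgebra v →+ R :=
    { toFun := c13, map_zero' := rfl, map_add' := fun _ _ => rfl }
  have h := congrArg π (congrFun (congrFun hX i) j)
  rw [Matrix.mul_apply, map_sum] at h
  rw [Matrix.mul_apply]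
  refine Eq.trans (Finset.sum_congr rfl fun l _ => ?_) h
  rw [Matrix.map_apply, Matrix.map_apply, of12_mul]
  rfl

/-- The system `A * X = B` over `R` is solvable if and only if the corresponding system over the path
algebra is. -/
theorem exists_colift_iff {m n p : Type*} [Fintype n] (A : Matrix m n R) (B : Matrix m p R) :
    (∃ X : Matrix n p R, A * X = B) ↔
      ∃ X : Matrix n p (PathAlgebra v), A.map (of12 v) * X = B.map (of13 v) := by
  refine ⟨?_, fun ⟨X, hX⟩ => ⟨X.map c23, mul_map_c23_of_colift v hX⟩⟩
  rintro ⟨X, rfl⟩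
  refine ⟨X.map (incl23 v), ?_⟩
  ext1 i j
  have : ∀ r, of13 v r = incl13 v r := fun _ => rfl
  rw [Matrix.mul_apply, Matrix.map_apply, Matrix.mul_apply, this, map_sum]
  refine Finset.sum_congr rfl fun l _ => ?_
  rw [Matrix.map_apply, Matrix.map_apply, of12_mul]
  ext1 <;> simp [incl23, incl13]

end Colift

end PathAlgebra

/-! ### Certificates of unsolvability -/

namespace PathAlgebra

theorem le_sum_range_sum_range (f : ℕ → ℕ → ℕ) {m n i j : ℕ} (hi : i < m) (hj : j < n) :
    f i j ≤ ∑ i ∈ Finset.range m, ∑ j ∈ Finset.range n, f i j :=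
  (Finset.single_le_sum (f := f i) (fun _ _ => Nat.zero_le _) (Finset.mem_range.2 hj)).trans
    (Finset.single_le_sum (f := fun i => ∑ j ∈ Finset.range n, f i j)
      (fun _ _ => Nat.zero_le _) (Finset.mem_range.2 hi))

section Functional

variable {k R Ck : Type*} [Field k] [Ring R] [Algebra k R] (v : Module.Basis ℕ k R) (νk : Ck → k)

/-- The functional on rows of length `p` over the path algebra coded by a list of positions,
coordinates and scalars. -/
noncomputable def rowFunctional (p : ℕ) (c : List ((ℕ × ℕ × ℕ × ℕ × ℕ) × Ck)) :
    (ℕ → PathAlgebra v) →ₗ[k] k :=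
  (c.map fun q => νk q.2 • if q.1.1 < p then coord v q.1.2 ∘ₗ LinearMap.proj q.1.1 else 0).sum

theorem rowFunctional_apply (p : ℕ) (c : List ((ℕ × ℕ × ℕ × ℕ × ℕ) × Ck))
    (r : ℕ → PathAlgebra v) : rowFunctional v νk p c r =
      (c.map fun q => νk q.2 * if q.1.1 < p then coord v q.1.2 (r q.1.1) else 0).sum := by
  induction c with
  | nil => simp [rowFunctional]
  | cons q c ih =>
    simp only [rowFunctional, List.map_cons, List.sum_cons, LinearMap.add_apply] at ih ⊢
    rw [ih, LinearMap.smul_apply, smul_eq_mul]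
    split_ifs <;> rfl

/-- Rows are functions on all of `ℕ`, to avoid dependence on `p` in the types; the test `q.1.1 < p`
makes their values beyond `p` irrelevant. -/
theorem rowFunctional_congr {p : ℕ} (c : List ((ℕ × ℕ × ℕ × ℕ × ℕ) × Ck))
    {r r' : ℕ → PathAlgebra v} (h : ∀ l < p, r l = r' l) :
    rowFunctional v νk p c r = rowFunctional v νk p c r' := by
  rw [rowFunctional_apply, rowFunctional_apply]
  congr 2
  ext q
  split_ifs with hq
  · rw [h _ hq]
  · rfl

/-- A functional that vanishes on the multiples of the rows of `A` by generators vanishes on all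
combinations of these rows with coefficients in the span of the generators. -/
theorem rowFunctional_eq_zero {n p N : ℕ} {c : List ((ℕ × ℕ × ℕ × ℕ × ℕ) × Ck)}
    {A : ℕ → ℕ → PathAlgebra v}
    (h : ∀ j < n, ∀ t < N, rowFunctional v νk p c (fun l => genSeq v t * A j l) = 0)
    {x : Fin n → PathAlgebra v}
    (hx : ∀ j, x j ∈ Submodule.span k (genSeq v '' Finset.range N)) :
    rowFunctional v νk p c (fun l => ∑ j : Fin n, x j * A j l) = 0 := by
  have hsum : (fun l => ∑ j : Fin n, x j * A j l) = ∑ j : Fin n, fun l => x j * A j l := by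
    ext1 l
    rw [Finset.sum_apply]
  rw [hsum, map_sum]
  refine Finset.sum_eq_zero fun j _ => ?_
  -- The value on a multiple of row `j` is `k`-linear in the multiplier, so its kernel contains the
  -- span of the generators once it contains the generators.
  let Φ : PathAlgebra v →ₗ[k] k :=
    rowFunctional v νk p c ∘ₗ LinearMap.pi fun l => LinearMap.mulRight k (A j l)
  have hle : Submodule.span k (genSeq v '' Finset.range N) ≤ LinearMap.ker Φ := by
    rw [Submodule.span_le]
    rintro _ ⟨t, ht, rfl⟩
    exact h j j.2 t (by simpa using ht)
  exact hle (hx j)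

/-- The coordinates of a row of length `p` over the path algebra. -/
noncomputable def rowCoords (p : ℕ) : (ℕ → PathAlgebra v) →ₗ[k] (ℕ × ℕ × ℕ × ℕ × ℕ → k) :=
  LinearMap.pi fun q => if q.1 < p then coord v q.2 ∘ₗ LinearMap.proj q.1 else 0

theorem rowCoords_apply (p : ℕ) (r : ℕ → PathAlgebra v) (q : ℕ × ℕ × ℕ × ℕ × ℕ) :
    rowCoords v p r q = if q.1 < p then coord v q.2 (r q.1) else 0 := by
  rw [rowCoords, LinearMap.pi_apply]
  split_ifs <;> rfl

theorem exists_combination_of_mem_span {n N : ℕ} {A : ℕ → ℕ → PathAlgebra v}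
    {r : ℕ → PathAlgebra v}
    (hr : r ∈ Submodule.span k ((fun (q : ℕ × ℕ) l => genSeq v q.2 * A q.1 l) ''
      (Finset.range n ×ˢ Finset.range N : Finset (ℕ × ℕ)))) :
    ∃ x : Fin n → PathAlgebra v, ∀ l, ∑ j, x j * A j l = r l := by
  induction hr using Submodule.span_induction with
  | mem f hf =>
    obtain ⟨⟨j, t⟩, hjt, rfl⟩ := hf
    have hj : j < n := Finset.mem_range.1 (Finset.mem_product.1 hjt).1
    refine ⟨Pi.single ⟨j, hj⟩ (genSeq v t), fun l => ?_⟩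
    rw [Finset.sum_eq_single ⟨j, hj⟩]
    · rw [Pi.single_eq_same]
    · intro i _ hi
      rw [Pi.single_eq_of_ne hi, zero_mul]
    · exact fun H => absurd (Finset.mem_univ _) H
  | zero => exact ⟨0, fun l => Finset.sum_eq_zero fun j _ => zero_mul _⟩
  | add f g _ _ hf hg =>
    obtain ⟨x, hx⟩ := hf
    obtain ⟨y, hy⟩ := hg
    refine ⟨x + y, fun l => ?_⟩
    rw [Pi.add_apply, ← hx, ← hy, ← Finset.sum_add_distrib]
    exact Finset.sum_congr rfl fun j _ => add_mul _ _ _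
  | smul a f _ hf =>
    obtain ⟨x, hx⟩ := hf
    refine ⟨a • x, fun l => ?_⟩
    rw [Pi.smul_apply, ← hx, Finset.smul_sum]
    exact Finset.sum_congr rfl fun j _ => by rw [Pi.smul_apply, smul_mul_assoc]

/-- Coordinates separate elements of `P` (`ext_coord`), so a linear relation between coordinate
vectors is one between the first `p` entries of the rows. -/
theorem exists_combination_of_rowCoords_mem_span {n p N : ℕ} {A : ℕ → ℕ → PathAlgebra v}
    {b : ℕ → PathAlgebra v}
    (hb : rowCoords v p b ∈ Submodule.span k
      ((fun q : ℕ × ℕ => rowCoords v p fun l => genSeq v q.2 * A q.1 l) ''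
        (Finset.range n ×ˢ Finset.range N : Finset (ℕ × ℕ)))) :
    ∃ x : Fin n → PathAlgebra v, ∀ l < p, ∑ j, x j * A j l = b l := by
  rw [← Set.image_image (rowCoords v p) (fun (q : ℕ × ℕ) l => genSeq v q.2 * A q.1 l),
    Submodule.span_image] at hb
  obtain ⟨r, hr, e⟩ := hb
  obtain ⟨x, hx⟩ := exists_combination_of_mem_span v hr
  refine ⟨x, fun l hl => (hx l).trans (ext_coord v fun t => ?_)⟩
  have := congrFun e (l, t)
  rwa [rowCoords_apply, rowCoords_apply, if_pos hl, if_pos hl] at this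

theorem rowFunctional_map (p : ℕ) {code : k → Ck} (hcode : ∀ x, νk (code x) = x)
    (c : List ((ℕ × ℕ × ℕ × ℕ × ℕ) × k)) (r : ℕ → PathAlgebra v) :
    rowFunctional v νk p (c.map fun q => (q.1, code q.2)) r =
      (c.map fun q => q.2 * rowCoords v p r q.1).sum := by
  rw [rowFunctional_apply, List.map_map]
  congr 1
  refine List.map_congr_left fun q _ => ?_
  rw [Function.comp_apply, hcode, rowCoords_apply]

/-- If a row is no combination of the rows of `A`, then some functional certifies this. -/
theorem exists_rowFunctional (hk : Function.Surjective νk) (n p N : ℕ)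
    (A : ℕ → ℕ → PathAlgebra v) (b : ℕ → PathAlgebra v)
    (hb : ¬∃ x : Fin n → PathAlgebra v, ∀ l < p, ∑ j, x j * A j l = b l) :
    ∃ c : List ((ℕ × ℕ × ℕ × ℕ × ℕ) × Ck),
      (∀ j < n, ∀ t < N, rowFunctional v νk p c (fun l => genSeq v t * A j l) = 0) ∧
        rowFunctional v νk p c b ≠ 0 := by
  obtain ⟨Φ, hΦ, h0, h1⟩ := exists_mem_span_proj_of_notMem_span
    (fun q : ℕ × ℕ => rowCoords v p fun l => genSeq v q.2 * A q.1 l)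
    (Finset.range n ×ˢ Finset.range N) (rowCoords v p b)
    fun hmem => hb (exists_combination_of_rowCoords_mem_span v hmem)
  obtain ⟨c, hc⟩ := exists_list_of_mem_span_proj hΦ
  choose code hcode using hk
  refine ⟨c.map fun q => (q.1, code q.2), fun j hj t ht => ?_, ?_⟩
  · have hjt : (j, t) ∈ Finset.range n ×ˢ Finset.range N :=
      Finset.mem_product.2 ⟨Finset.mem_range.2 hj, Finset.mem_range.2 ht⟩
    have h := h0 (j, t) hjt
    rw [hc] at h
    rw [rowFunctional_map v νk p hcode]
    exact h
  · rw [hc] at h1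
    rw [rowFunctional_map v νk p hcode]
    exact h1

end Functional

/-! ### Soundness and completeness of certificates; coded systems -/

section Codes

variable {k R Ck CR : Type*} [Field k] [Ring R] [Algebra k R] {νk : Ck → k} {νR : CR → R}
  {v : Module.Basis ℕ k R}

/-- `(i, c)` is a certificate for the unsolvability of `X * A = B`: the functional coded by `c` does
not vanish on row `i` of `B`, but on all multiples of the rows of `A` by the first `N` generators. -/
def IsCertificate (v : Module.Basis ℕ k R) (νk : Ck → k) (νR : CR → R) (N : ℕ)
    (s : SysCode (Code Ck CR)) (y : ℕ × List ((ℕ × ℕ × ℕ × ℕ × ℕ) × Ck)) : Prop :=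
  y.1 < s.1.1 ∧
    ¬rowFunctional v νk s.1.2.2 y.2 (fun l => entry (name v νk νR) s.2.2 y.1 l) = 0 ∧
    ∀ j < s.1.2.1, ∀ t < N, rowFunctional v νk s.1.2.2 y.2
      (fun l => genSeq v t * entry (name v νk νR) s.2.1 j l) = 0

/-- A solution could be chosen with entries in `P^d'`, hence in the span of the first `N`
generators. Row `y.1` of `B` would then be a combination on which the functional vanishes. -/
theorem not_exists_of_isCertificate {N m n p d d' : ℕ} {a b : MatCode (Code Ck CR)}
    {y : ℕ × List ((ℕ × ℕ × ℕ × ℕ × ℕ) × Ck)} (hN : genBound d' ≤ N) (h : d ≤ d')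
    (hmul : ∀ r ∈ truncSpace v d, ∀ s ∈ truncSpace v d, r * s ∈ truncSpace v d')
    (ha : ∀ i j, readMat (name v νk νR) n p a i j ∈ trunc v d)
    (hb : ∀ i j, readMat (name v νk νR) m p b i j ∈ trunc v d)
    (hy : IsCertificate v νk νR N ((m, n, p), a, b) y) :
    ¬∃ X : Matrix (Fin m) (Fin n) (PathAlgebra v),
      X * readMat (name v νk νR) n p a = readMat (name v νk νR) m p b := by
  rintro ⟨X, hX⟩
  obtain ⟨Y, hY, e⟩ := exists_solution_mem_trunc v h hmul ha hb hX
  obtain ⟨hi, hne, hz⟩ := hy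
  refine hne ?_
  rw [← rowFunctional_eq_zero v νk (fun j hj t ht => hz j hj t (lt_of_lt_of_le ht hN))
    (x := Y ⟨y.1, hi⟩) fun j => trunc_le_span v d' (hY _ j)]
  refine rowFunctional_congr v νk _ fun l hl => ?_
  exact (congrFun (congrFun e ⟨y.1, hi⟩) ⟨l, hl⟩).symm

/-- The system splits into its rows, so one row of `B` is no combination of the rows of `A` with
coefficients in `P`, and a fortiori not in the span of finitely many multiples. Thus `N` may be
arbitrary here; only soundness requires it to be large. -/
theorem exists_isCertificate (hk : Function.Surjective νk) (N m n p : ℕ)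
    (a b : MatCode (Code Ck CR))
    (h : ¬∃ X : Matrix (Fin m) (Fin n) (PathAlgebra v),
      X * readMat (name v νk νR) n p a = readMat (name v νk νR) m p b) :
    ∃ y, IsCertificate v νk νR N ((m, n, p), a, b) y := by
  have hrow : ∃ i : Fin m, ¬∃ x : Fin n → PathAlgebra v, ∀ l < p,
      ∑ j, x j * entry (name v νk νR) a j l = entry (name v νk νR) b i l := by
    by_contra! H
    choose X hX using H
    exact h ⟨Matrix.of X, Matrix.ext fun i l => hX i l l.2⟩
  obtain ⟨i, hi⟩ := hrow
  obtain ⟨c, h0, h1⟩ := exists_rowFunctional v νk hk n p N (entry (name v νk νR) a)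
    (entry (name v νk νR) b i) hi
  exact ⟨(i, c), i.2, h1, h0⟩

/-- The condition `g 0 = 0` is needed for the positions missing from the code, which are read as
zero on both sides. -/
theorem readMat_map_map {C C' S S' : Type*} [Zero S] [Zero S'] {ν : C → S} {ν' : C' → S'}
    {f : C → C'} {g : S → S'} (h : ∀ c, ν' (f c) = g (ν c)) (h0 : g 0 = 0) (m n : ℕ)
    (a : MatCode C) : readMat ν' m n (a.map (List.map f)) = (readMat ν m n a).map g := by
  ext i j
  simp only [readMat, Matrix.map_apply, List.getElem?_map]
  cases a[i.1]? with
  | none => simp [h0]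
  | some row =>
    simp only [Option.map_some, Option.bind_some, List.getElem?_map]
    cases row[j.1]? <;> simp [h, h0]

/-- The code of an element of `R` as an arrow from `z₁` to `z₂`. -/
def code12 (zk : Ck) (zR : CR) (c : CR) : Code Ck CR := ((zk, zk, zk), (c, []), zR, zR)

/-- The code of an element of `R` as an arrow from `z₁` to `z₃`. -/
def code13 (zk : Ck) (zR : CR) (c : CR) : Code Ck CR := ((zk, zk, zk), (zR, []), zR, c)

/-- The system over the path algebra that corresponds to a system over `R`. -/
def pathSystem (zk : Ck) (zR : CR) (s : SysCode CR) : SysCode (Code Ck CR) :=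
  (s.1, s.2.1.map (List.map (code12 zk zR)), s.2.2.map (List.map (code13 zk zR)))

theorem readMat_code12 {zk : Ck} {zR : CR} (hzk : νk zk = 0) (hzR : νR zR = 0) (m n : ℕ)
    (a : MatCode CR) :
    readMat (name v νk νR) m n (a.map (List.map (code12 zk zR))) =
      (readMat νR m n a).map (of12 v) :=
  readMat_map_map (fun c => by simp [name, code12, of12, hzk, hzR, readOps]) rfl m n a

theorem readMat_code13 {zk : Ck} {zR : CR} (hzk : νk zk = 0) (hzR : νR zR = 0) (m n : ℕ)
    (a : MatCode CR) :
    readMat (name v νk νR) m n (a.map (List.map (code13 zk zR))) =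
      (readMat νR m n a).map (of13 v) :=
  readMat_map_map (fun c => by simp [name, code13, of13, hzk, hzR, readOps]) rfl m n a

end Codes

/-! ### Computability of coordinates, generators, bounds and certificates -/

variable {k R Ck CR : Type*} [Field k] [Ring R] [Algebra k R] [Primcodable Ck] [Primcodable CR]
  {νk : Ck → k} {νR : CR → R} (hk : IsEffectiveRing νk) (hR : IsEffectiveAlgebra νk νR)
  {v : Module.Basis ℕ k R} (hv : IsEnumerable νR v)

section

variable {α : Type*} [Primcodable α]

include hk hR hv in
theorem computableVia_coord {f : α → PathAlgebra v} {t : α → ℕ × ℕ × ℕ × ℕ}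
    (hf : ComputableVia (name v νk νR) f) (ht : Computable t) :
    ComputableVia νk fun a => coord v (t a) (f a) := by
  have htag : ∀ n, ComputablePred fun a => (t a).1 = n := fun n =>
    computablePred_eq (Computable.fst.comp ht) (Computable.const n)
  have hi : Computable fun a => (t a).2.1 := Computable.fst.comp (Computable.snd.comp ht)
  have ha : Computable fun a => (t a).2.2.1 :=
    Computable.fst.comp (Computable.snd.comp (Computable.snd.comp ht))
  have hb : Computable fun a => (t a).2.2.2 :=
    Computable.snd.comp (Computable.snd.comp (Computable.snd.comp ht))
  exact ComputableVia.ite (htag 0) (computableVia_c11 hf) <|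
    ComputableVia.ite (htag 1) (computableVia_c22 hf) <|
    ComputableVia.ite (htag 2) (computableVia_c33 hf) <|
    ComputableVia.ite (htag 3) (computableVia_repr hk hR hv (computableVia_c12_fst hf) hi) <|
    ComputableVia.ite (htag 4) (computableVia_repr hk hR hv (computableVia_c23 hf) hi) <|
    ComputableVia.ite (htag 5) (computableVia_repr hk hR hv (computableVia_c13 hf) hi) <|
    computableVia_opCoeff hk (computableVia_c12_snd hf) hi ha hb

include hk in
theorem computableVia_unitOp {i a b : α → ℕ} (hi : Computable i) (ha : Computable a)
    (hb : Computable b) :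
    ComputableVia (readOps v νk) fun x => unitOp v (i x) (a x) (b x) := by
  have h3 : Computable fun q : ((α × ℕ) × ℕ) × ℕ => q.1.1.1 :=
    Computable.fst.comp (Computable.fst.comp Computable.fst)
  have hj : Computable fun q : ((α × ℕ) × ℕ) × ℕ => q.1.1.2 :=
    Computable.snd.comp (Computable.fst.comp Computable.fst)
  have hx : Computable fun q : ((α × ℕ) × ℕ) × ℕ => q.1.2 := Computable.snd.comp Computable.fst
  have hy : Computable fun q : ((α × ℕ) × ℕ) × ℕ => q.2 := Computable.snd
  refine computableVia_readOps hk (N := fun x => i x + 1) ?_ (Computable.succ.comp hi)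
    fun x j h => unitOp_apply_eq_zero v h _ _
  refine (ComputableVia.ite
    (computablePred_and (computablePred_eq (hi.comp h3) hj) (computablePred_and
      (computablePred_nat_lt hx hj) (computablePred_nat_lt hy hj)))
    (ComputableVia.ite (computablePred_and (computablePred_eq hx (ha.comp h3))
      (computablePred_eq hy (hb.comp h3))) (hk.const 1) (hk.const 0)) (hk.const 0)).of_eq
    fun q => ?_
  rw [opCoeff_unitOp]

include hk hR hv in
theorem computableVia_genSeq {t : α → ℕ} (ht : Computable t) :
    ComputableVia (name v νk νR) fun a => genSeq v (t a) := by
  have ht' : Computable fun a => Denumerable.ofNat (ℕ × ℕ × ℕ × ℕ) (t a) :=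
    (Computable.ofNat _).comp ht
  have htag : ∀ n, ComputablePred fun a => (Denumerable.ofNat (ℕ × ℕ × ℕ × ℕ) (t a)).1 = n :=
    fun n => computablePred_eq (Computable.fst.comp ht') (Computable.const n)
  have hi := Computable.fst.comp (Computable.snd.comp ht')
  have ha := Computable.fst.comp (Computable.snd.comp (Computable.snd.comp ht'))
  have hb := Computable.snd.comp (Computable.snd.comp (Computable.snd.comp ht'))
  have h0 : ComputableVia νR fun _ : α => (0 : R) := hR.const 0
  have hvi := hv.computableVia hi
  exact computableVia_mk
    (ComputableVia.ite (htag 0) (hk.const 1) (hk.const 0))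
    (ComputableVia.ite (htag 1) (hk.const 1) (hk.const 0))
    (ComputableVia.ite (htag 2) (hk.const 1) (hk.const 0))
    (ComputableVia.ite (htag 3) hvi h0)
    (ComputableVia.ite (htag 6) (computableVia_unitOp hk hi ha hb)
      (ComputableVia.const 0 (isEffectiveAdd_readOps hk).zero))
    (ComputableVia.ite (htag 4) hvi h0) (ComputableVia.ite (htag 5) hvi h0)

include hk hR hv in
theorem computableVia_rowFunctional {p : α → ℕ} {c : α → List ((ℕ × ℕ × ℕ × ℕ × ℕ) × Ck)}
    {r : α → ℕ → PathAlgebra v} (hp : Computable p) (hc : Computable c)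
    (hr : ComputableVia (name v νk νR) fun q : α × ℕ => r q.1 q.2) :
    ComputableVia νk fun a => rowFunctional v νk (p a) (c a) (r a) := by
  have hpos : Computable fun q : α × (ℕ × ℕ × ℕ × ℕ × ℕ) × Ck => q.2.1 :=
    Computable.fst.comp Computable.snd
  have hl : Computable fun q : α × (ℕ × ℕ × ℕ × ℕ × ℕ) × Ck => q.2.1.1 :=
    Computable.fst.comp hpos
  refine (ComputableVia.sum_list hk.isEffectiveAdd hc
    (f := fun a q => νk q.2 * if q.1.1 < p a then coord v q.1.2 (r a q.1.1) else 0)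
    (hk.computableVia_mul
      (ComputableVia.of_computable (Computable.snd.comp Computable.snd))
      (ComputableVia.ite (computablePred_nat_lt hl (hp.comp Computable.fst))
        (computableVia_coord hk hR hv (hr.comp (Computable.fst.pair hl))
          (Computable.snd.comp hpos)) (hk.const 0)))).of_eq fun a => ?_
  rw [rowFunctional_apply]

include hk hR hv in
theorem exists_computable_path_degree {f : α → PathAlgebra v}
    (hf : ComputableVia (name v νk νR) f) :
    ∃ deg : α → ℕ, Computable deg ∧ ∀ a, f a ∈ trunc v (deg a) := by
  obtain ⟨d₁, h₁, e₁⟩ := exists_computable_degree hk hR hv (computableVia_c12_fst hf)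
  obtain ⟨d₂, h₂, e₂⟩ := exists_computable_opsBound (computableVia_c12_snd hf)
  obtain ⟨d₃, h₃, e₃⟩ := exists_computable_degree hk hR hv (computableVia_c23 hf)
  obtain ⟨d₄, h₄, e₄⟩ := exists_computable_degree hk hR hv (computableVia_c13 hf)
  have hadd := Primrec.nat_add.to_comp
  refine ⟨fun a => d₁ a + d₂ a + (d₃ a + d₄ a), hadd.comp (hadd.comp h₁ h₂) (hadd.comp h₃ h₄),
    fun a => ⟨?_, fun j hj => e₂ a j (by simp only at hj; omega), ?_, ?_⟩⟩
  · exact truncSpace_mono v (by simp only; omega) (e₁ a)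
  · exact truncSpace_mono v (by simp only; omega) (e₃ a)
  · exact truncSpace_mono v (by simp only; omega) (e₄ a)

end

include hk hR hv in
-- By bilinearity it is enough to bound the degrees of the products `v i * v j` with `i, j < d`.
-- Their sum serves as a bound for all of them, and the summand `d` secures `d ≤ e d`.
theorem exists_computable_mul_bound : ∃ e : ℕ → ℕ, Computable e ∧ ∀ d, d ≤ e d ∧
    ∀ r ∈ truncSpace v d, ∀ s ∈ truncSpace v d, r * s ∈ truncSpace v (e d) := by
  obtain ⟨μ, hμ, eμ⟩ := exists_computable_degree hk hR hv
    (hR.computableVia_mul (hv.computableVia (Computable.fst (α := ℕ) (β := ℕ)))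
      (hv.computableVia Computable.snd))
  have hμsum : Computable fun d : ℕ =>
      ∑ i ∈ Finset.range d, ∑ j ∈ Finset.range d, μ (i, j) := by
    refine computable_sum_range (f := fun d i => ∑ j ∈ Finset.range d, μ (i, j)) ?_ Computable.id
    refine computable_sum_range (f := fun (q : ℕ × ℕ) j => μ (q.2, j)) ?_ Computable.fst
    exact hμ.comp ((Computable.snd.comp Computable.fst).pair Computable.snd)
  refine ⟨fun d => d + ∑ i ∈ Finset.range d, ∑ j ∈ Finset.range d, μ (i, j),
    Primrec.nat_add.to_comp.comp Computable.id hμsum, fun d => ⟨Nat.le_add_right _ _, ?_⟩⟩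
  intro r hr s hs
  rw [← sum_repr_of_mem_truncSpace v hr, ← sum_repr_of_mem_truncSpace v hs, Finset.sum_mul_sum]
  refine sum_mem fun i hi => sum_mem fun j hj => ?_
  rw [smul_mul_smul_comm]
  refine Submodule.smul_mem _ _ (truncSpace_mono v ?_ (eμ (i, j)))
  exact (le_sum_range_sum_range (fun i j => μ (i, j)) (Finset.mem_range.1 hi)
    (Finset.mem_range.1 hj)).trans (Nat.le_add_left _ _)

include hk hR hv in
theorem exists_computable_matrix_degree : ∃ δ : ℕ × ℕ × MatCode (Code Ck CR) → ℕ, Computable δ ∧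
    ∀ m n a i j, readMat (name v νk νR) m n a i j ∈ trunc v (δ (m, n, a)) := by
  obtain ⟨deg, hdeg, edeg⟩ := exists_computable_path_degree hk hR hv
    (computableVia_entry (isEffectiveAlgebra_name hk hR hv).isEffectiveAdd)
  refine ⟨fun q => ∑ i ∈ Finset.range q.1, ∑ j ∈ Finset.range q.2.1, deg (q.2.2, i, j), ?_,
    fun m n a i j => ?_⟩
  · refine computable_sum_range (f := fun (q : ℕ × ℕ × MatCode (Code Ck CR)) i =>
      ∑ j ∈ Finset.range q.2.1, deg (q.2.2, i, j)) ?_ Computable.fst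
    refine computable_sum_range (f := fun (q : (ℕ × ℕ × MatCode (Code Ck CR)) × ℕ) j =>
      deg (q.1.2.2, q.2, j)) ?_ (Computable.fst.comp (Computable.snd.comp Computable.fst))
    exact hdeg.comp ((Computable.snd.comp
      (Computable.snd.comp (Computable.fst.comp Computable.fst))).pair
      ((Computable.snd.comp Computable.fst).pair Computable.snd))
  · exact trunc_mono v (le_sum_range_sum_range (fun i j => deg (a, i, j)) i.2 j.2)
      (edeg (a, i, j))

include hk hR hv in
/-- Numbers `d ≤ d'` such that `P^d` contains the entries of a system and `R^d * R^d ⊆ R^d'` can be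
computed from the system. -/
theorem exists_computable_bounds : ∃ D : SysCode (Code Ck CR) → ℕ × ℕ, Computable D ∧
    ∀ (m n p : ℕ) (a b : MatCode (Code Ck CR)) (d d' : ℕ), D ((m, n, p), a, b) = (d, d') →
      d ≤ d' ∧
      (∀ r ∈ truncSpace v d, ∀ s ∈ truncSpace v d, r * s ∈ truncSpace v d') ∧
      (∀ i j, readMat (name v νk νR) n p a i j ∈ trunc v d) ∧
      (∀ i j, readMat (name v νk νR) m p b i j ∈ trunc v d) := by
  obtain ⟨δ, hδ, eδ⟩ := exists_computable_matrix_degree hk hR hv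
  obtain ⟨e, he, ee⟩ := exists_computable_mul_bound hk hR hv
  have hm : Computable fun s : SysCode (Code Ck CR) => s.1.1 := Computable.fst.comp Computable.fst
  have hn : Computable fun s : SysCode (Code Ck CR) => s.1.2.1 :=
    Computable.fst.comp (Computable.snd.comp Computable.fst)
  have hp : Computable fun s : SysCode (Code Ck CR) => s.1.2.2 :=
    Computable.snd.comp (Computable.snd.comp Computable.fst)
  have hd : Computable fun s : SysCode (Code Ck CR) =>
      δ (s.1.2.1, s.1.2.2, s.2.1) + δ (s.1.1, s.1.2.2, s.2.2) :=
    Primrec.nat_add.to_comp.comp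
      (hδ.comp (hn.pair (hp.pair (Computable.fst.comp Computable.snd))))
      (hδ.comp (hm.pair (hp.pair (Computable.snd.comp Computable.snd))))
  refine ⟨_, hd.pair (he.comp hd), fun m n p a b d d' h => ?_⟩
  rw [Prod.mk.injEq] at h
  obtain ⟨rfl, rfl⟩ := h
  exact ⟨(ee _).1, (ee _).2, fun i j => trunc_mono v (Nat.le_add_right _ _) (eδ n p a i j),
    fun i j => trunc_mono v (Nat.le_add_left _ _) (eδ m p b i j)⟩

theorem computable_genBound : Computable genBound := by
  have h : Computable fun d : ℕ => d + 1 := Computable.succ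
  have hp := Primrec₂.natPair.to_comp
  exact hp.comp (Computable.const 7) (hp.comp h (hp.comp h h))

include hk hR hv in
theorem computablePred_isCertificate {N : SysCode (Code Ck CR) → ℕ} (hN : Computable N) :
    ComputablePred fun q : SysCode (Code Ck CR) × ℕ × List ((ℕ × ℕ × ℕ × ℕ × ℕ) × Ck) =>
      IsCertificate v νk νR (N q.1) q.1 q.2 := by
  have hP := isEffectiveAlgebra_name hk hR hv
  have he := computableVia_entry hP.isEffectiveAdd
  have hm : Computable fun s : SysCode (Code Ck CR) => s.1.1 := Computable.fst.comp Computable.fst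
  have hn : Computable fun s : SysCode (Code Ck CR) => s.1.2.1 :=
    Computable.fst.comp (Computable.snd.comp Computable.fst)
  have hp : Computable fun s : SysCode (Code Ck CR) => s.1.2.2 :=
    Computable.snd.comp (Computable.snd.comp Computable.fst)
  refine computablePred_and (computablePred_nat_lt (Computable.fst.comp Computable.snd)
    (hm.comp Computable.fst)) (computablePred_and (ComputablePred.not ?_) ?_)
  · refine hk.computablePred_eq (computableVia_rowFunctional hk hR hv
      (r := fun (q : SysCode (Code Ck CR) × ℕ × List ((ℕ × ℕ × ℕ × ℕ × ℕ) × Ck)) l =>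
        entry (name v νk νR) q.1.2.2 q.2.1 l)
      (hp.comp Computable.fst) (Computable.snd.comp Computable.snd) ?_) (hk.const 0)
    exact he.comp (((Computable.snd.comp Computable.snd).comp
      (Computable.fst.comp Computable.fst)).pair
      ((Computable.fst.comp (Computable.snd.comp Computable.fst)).pair Computable.snd))
  · refine computablePred_forall_lt (p := fun
      (q : SysCode (Code Ck CR) × ℕ × List ((ℕ × ℕ × ℕ × ℕ × ℕ) × Ck)) j =>
      ∀ t < N q.1, rowFunctional v νk q.1.1.2.2 q.2.2
        (fun l => genSeq v t * entry (name v νk νR) q.1.2.1 j l) = 0) ?_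
      (hn.comp Computable.fst)
    refine computablePred_forall_lt (p := fun
      (q : (SysCode (Code Ck CR) × ℕ × List ((ℕ × ℕ × ℕ × ℕ × ℕ) × Ck)) × ℕ) t =>
      rowFunctional v νk q.1.1.1.2.2 q.1.2.2
        (fun l => genSeq v t * entry (name v νk νR) q.1.1.2.1 q.2 l) = 0) ?_
      (hN.comp (Computable.fst.comp Computable.fst))
    refine hk.computablePred_eq (computableVia_rowFunctional hk hR hv
      (r := fun (q : ((SysCode (Code Ck CR) × ℕ × List ((ℕ × ℕ × ℕ × ℕ × ℕ) × Ck)) × ℕ) × ℕ) l =>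
        genSeq v q.2 * entry (name v νk νR) q.1.1.1.2.1 q.1.2 l)
      (hp.comp (Computable.fst.comp (Computable.fst.comp Computable.fst)))
      (Computable.snd.comp (Computable.snd.comp (Computable.fst.comp Computable.fst))) ?_)
      (hk.const 0)
    refine hP.computableVia_mul
      (computableVia_genSeq hk hR hv (Computable.snd.comp Computable.fst)) ?_
    exact he.comp (((Computable.fst.comp Computable.snd).comp
      (Computable.fst.comp (Computable.fst.comp (Computable.fst.comp Computable.fst)))).pair
      ((Computable.snd.comp (Computable.fst.comp Computable.fst)).pair Computable.snd))

/-! ### The decision procedure for lifts -/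

include hk hR hv in
/-- The path algebra has decidable lifts. -/
theorem hasDecidableLifts_name : HasDecidableLifts (name v νk νR) := by
  have hP := isEffectiveAlgebra_name hk hR hv
  obtain ⟨D, hD, eD⟩ := exists_computable_bounds hk hR hv
  have hN : Computable fun s => genBound (D s).2 :=
    computable_genBound.comp (Computable.snd.comp hD)
  have hflag : Computable fun q : SysCode (Code Ck CR) × Bool × MatCode (Code Ck CR) ×
      ℕ × List ((ℕ × ℕ × ℕ × ℕ × ℕ) × Ck) => q.2.1 := Computable.fst.comp Computable.snd
  -- The object of the search carries a flag: `true` promises that the coded matrix is a solution,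
  -- `false` that the last component is a certificate, and the other slot is unconstrained. Both
  -- promises are decidable, and one of them can always be kept.
  obtain ⟨f, hf, ef⟩ := exists_computable_choice
    (p := fun (s : SysCode (Code Ck CR)) (z : Bool × MatCode (Code Ck CR) ×
      ℕ × List ((ℕ × ℕ × ℕ × ℕ × ℕ) × Ck)) =>
      (z.1 = true → readMat (name v νk νR) s.1.1 s.1.2.1 z.2.1 *
        readMat (name v νk νR) s.1.2.1 s.1.2.2 s.2.1 =
          readMat (name v νk νR) s.1.1 s.1.2.2 s.2.2) ∧
      (z.1 = false → IsCertificate v νk νR (genBound (D s).2) s z.2.2))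
    (computablePred_and
      (computablePred_imp (computablePred_eq hflag (Computable.const true))
        (computablePred_comp (computablePred_readMat_mul_eq hP.toIsEffectiveRing)
          (Computable.fst.pair (Computable.fst.comp (Computable.snd.comp Computable.snd)))))
      (computablePred_imp (computablePred_eq hflag (Computable.const false))
        (computablePred_comp (computablePred_isCertificate hk hR hv hN)
          (Computable.fst.pair (Computable.snd.comp (Computable.snd.comp Computable.snd)))))) <| by
    rintro ⟨⟨m, n, p⟩, a, b⟩
    by_cases h : ∃ X : Matrix (Fin m) (Fin n) (PathAlgebra v),
        X * readMat (name v νk νR) n p a = readMat (name v νk νR) m p b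
    · obtain ⟨X, hX⟩ := h
      obtain ⟨x, rfl⟩ := exists_readMat_eq hP.surj m n X
      exact ⟨(true, x, 0, []), fun _ => hX, fun H => by simp at H⟩
    · obtain ⟨y, hy⟩ := exists_isCertificate (νR := νR) hk.surj
        (genBound (D ((m, n, p), a, b)).2) m n p a b h
      exact ⟨(false, [], y), fun H => by simp at H, fun _ => hy⟩
  refine ⟨fun s => cond (f s).1 (some (f s).2.1) none,
    Computable.cond (Computable.fst.comp hf)
      (Computable.option_some.comp (Computable.fst.comp (Computable.snd.comp hf)))
      (Computable.const none), fun m n p a b => ?_⟩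
  have hs := ef ((m, n, p), a, b)
  -- These bounds matter only when the flag is `false`, where they make the certificate refute
  -- solutions over all of `P`.
  obtain ⟨h1, h2, h3, h4⟩ := eD m n p a b _ _ rfl
  rcases hb : (f ((m, n, p), a, b)).1 with - | -
  · simp only [hb, cond_false, reduceCtorEq, false_implies, implies_true, true_and,
      forall_const]
    exact not_exists_of_isCertificate le_rfl h1 h2 h3 h4 (hs.2 hb)
  · simp only [hb, cond_true, Option.some.injEq, reduceCtorEq, false_implies, and_true]
    rintro x rfl
    exact hs.1 hb

/-! ### Reduction of the colifting problem on codes -/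

section Colift

theorem computable_map_map {C C' : Type*} [Primcodable C] [Primcodable C'] {f : C → C'}
    (hf : Primrec f) : Computable fun a : MatCode C => a.map (List.map f) :=
  (Primrec.list_map Primrec.id
    (Primrec.list_map Primrec.snd (hf.comp Primrec.snd).to₂).to₂).to_comp

theorem computable_pathSystem (zk : Ck) (zR : CR) : Computable (pathSystem zk zR) := by
  have h12 : Primrec (code12 zk zR) := (Primrec.const _).pair
    ((Primrec.id.pair (Primrec.const _)).pair (Primrec.const _))
  have h13 : Primrec (code13 zk zR) := (Primrec.const _).pair
    ((Primrec.const _).pair ((Primrec.const _).pair Primrec.id))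
  exact Computable.fst.pair
    (((computable_map_map h12).comp (Computable.fst.comp Computable.snd)).pair
      ((computable_map_map h13).comp (Computable.snd.comp Computable.snd)))

include hk hR in
/-- The colifting problem of `R` reduces to that of the path algebra. -/
theorem coliftProblem_reducible : ColiftProblem νR ≤₀ ColiftProblem (name v νk νR) := by
  obtain ⟨zk, hzk⟩ := hk.surj 0
  obtain ⟨zR, hzR⟩ := hR.surj 0
  refine ⟨pathSystem zk zR, computable_pathSystem zk zR, fun s => ?_⟩
  simp only [ColiftProblem, pathSystem, readMat_code12 hzk hzR, readMat_code13 hzk hzR]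
  exact exists_colift_iff v _ _

include hk hR in
-- Deciding is not enough here, a solution must be returned: the codes of the `(2,3)` components of
-- a solution over `P` name a solution over `R`.
theorem hasDecidableColifts_of_name (h : HasDecidableColifts (name v νk νR)) :
    HasDecidableColifts νR := by
  obtain ⟨zk, hzk⟩ := hk.surj 0
  obtain ⟨zR, hzR⟩ := hR.surj 0
  obtain ⟨f, hf, ef⟩ := h
  have hproj : Computable fun x : MatCode (Code Ck CR) => x.map (List.map fun c => c.2.2.1) :=
    computable_map_map (Primrec.fst.comp (Primrec.snd.comp Primrec.snd))
  have hF : Computable fun s => f (pathSystem zk zR s) := hf.comp (computable_pathSystem zk zR)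
  have hproj' : Computable₂ fun (_ : SysCode CR) (x : MatCode (Code Ck CR)) =>
      x.map (List.map fun c => c.2.2.1) := (hproj.comp Computable.snd).to₂
  refine ⟨_, Computable.option_map hF hproj', fun m n p a b => ?_⟩
  obtain ⟨h1, h2⟩ := ef m n p (a.map (List.map (code12 zk zR))) (b.map (List.map (code13 zk zR)))
  rw [readMat_code12 hzk hzR, readMat_code13 hzk hzR] at h1 h2
  constructor
  · intro x hx
    obtain ⟨y, hy, rfl⟩ := Option.map_eq_some_iff.1 hx
    rw [readMat_map_map (ν := name v νk νR) (ν' := νR) (f := fun c => c.2.2.1) (g := c23)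
      (fun _ => rfl) rfl]
    exact mul_map_c23_of_colift v (h1 y hy)
  · intro hx
    rw [exists_colift_iff v]
    exact h2 (Option.map_eq_none_iff.1 hx)

end Colift

end PathAlgebra

end EffAlg

theorem mainTheorem7 {k R Ck CR : Type*} [Field k] [Ring R] [Algebra k R]
    [Primcodable Ck] [Primcodable CR] (νk : Ck → k) (νR : CR → R)
    (hk : EffAlg.IsEffectiveRing νk) (hR : EffAlg.IsEffectiveAlgebra νk νR)
    (v : Module.Basis ℕ k R) (hv : EffAlg.IsEnumerable νR v) :
    -- the path algebra `P` is an algebra with decidable equality and decidable lifts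
    EffAlg.IsEffectiveAlgebra νk (EffAlg.PathAlgebra.name v νk νR) ∧
    EffAlg.HasDecidableLifts (EffAlg.PathAlgebra.name v νk νR) ∧
    -- lifts reduce to linear systems on the finite-dimensional spaces `P^d'`, with computable `d'`
    (∀ i, FiniteDimensional k (EffAlg.PathAlgebra.trunc v i)) ∧
    (∃ D : EffAlg.SysCode (EffAlg.PathAlgebra.Code Ck CR) → ℕ × ℕ, Computable D ∧
      ∀ (m n p : ℕ) (a b : EffAlg.MatCode (EffAlg.PathAlgebra.Code Ck CR)) (d d' : ℕ),
        D ((m, n, p), a, b) = (d, d') →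
        d ≤ d' ∧
        (∀ r ∈ EffAlg.truncSpace v d, ∀ s ∈ EffAlg.truncSpace v d,
          r * s ∈ EffAlg.truncSpace v d') ∧
        (∀ i j, EffAlg.readMat (EffAlg.PathAlgebra.name v νk νR) n p a i j ∈
          EffAlg.PathAlgebra.trunc v d) ∧
        (∀ i j, EffAlg.readMat (EffAlg.PathAlgebra.name v νk νR) m p b i j ∈
          EffAlg.PathAlgebra.trunc v d)) ∧
    (∀ (m n p : ℕ) (A : Matrix (Fin n) (Fin p) (EffAlg.PathAlgebra v))
      (B : Matrix (Fin m) (Fin p) (EffAlg.PathAlgebra v)) (d d' : ℕ),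
      d ≤ d' →
      (∀ r ∈ EffAlg.truncSpace v d, ∀ s ∈ EffAlg.truncSpace v d,
        r * s ∈ EffAlg.truncSpace v d') →
      (∀ i j, A i j ∈ EffAlg.PathAlgebra.trunc v d) →
      (∀ i j, B i j ∈ EffAlg.PathAlgebra.trunc v d) →
      ((∃ X : Matrix (Fin m) (Fin n) (EffAlg.PathAlgebra v), X * A = B) ↔
        ∃ X : Matrix (Fin m) (Fin n) (EffAlg.PathAlgebra v),
          (∀ i j, X i j ∈ EffAlg.PathAlgebra.trunc v d') ∧ X * A = B)) ∧
    -- the colifting problem of `R` reduces to that of `P`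
    (∀ (m n p : ℕ) (A : Matrix (Fin m) (Fin n) R) (B : Matrix (Fin m) (Fin p) R),
      (∃ X : Matrix (Fin n) (Fin p) R, A * X = B) ↔
        ∃ X : Matrix (Fin n) (Fin p) (EffAlg.PathAlgebra v),
          A.map (EffAlg.PathAlgebra.of12 v) * X = B.map (EffAlg.PathAlgebra.of13 v)) ∧
    EffAlg.ColiftProblem νR ≤₀ EffAlg.ColiftProblem (EffAlg.PathAlgebra.name v νk νR) ∧
    (EffAlg.HasDecidableColifts (EffAlg.PathAlgebra.name v νk νR) →
      EffAlg.HasDecidableColifts νR) := by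
  exact ⟨EffAlg.PathAlgebra.isEffectiveAlgebra_name hk hR hv,
    EffAlg.PathAlgebra.hasDecidableLifts_name hk hR hv,
    EffAlg.PathAlgebra.finiteDimensional_trunc v,
    EffAlg.PathAlgebra.exists_computable_bounds hk hR hv,
    fun m n p A B d d' h hmul hA hB =>
      ⟨fun ⟨X, hX⟩ => EffAlg.PathAlgebra.exists_solution_mem_trunc v h hmul hA hB hX,
        fun ⟨X, _, hX⟩ => ⟨X, hX⟩⟩,
    fun m n p A B => EffAlg.PathAlgebra.exists_colift_iff v A B,
    EffAlg.PathAlgebra.coliftProblem_reducible hk hR,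
    EffAlg.PathAlgebra.hasDecidableColifts_of_name hk hR⟩
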